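/- \textbf{Setting.} There are $n\ge 1$ nodes $V=\{1,\dots,n\}$, connected by a complete network with loops. Communication is synchronous and reliable; in each round every node can send one message to each node (itself included), so that each directed link carries at most one message per round. \textbf{Information distribution task.} Each node $v$ is given a finite set $\mathcal S_v$ of distinguishable messages, each with a destination in $V$; $\mathcal R_v$ is the set of all messages with destination $v$. All messages have to be delivered to their destinations. Let $M_s=\max_v|\mathcal S_v|$ and $M_r=\max_v|\mathcal R_v|$. \textbf{Algorithm $\mathcal A_g$.} The nodes repeat the following phase until termination. \begin{enumerate} \item Each node announces the number of messages it holds to all nodes. If no node has any messages left, terminate. \item The messages are redistributed so that all nodes hold, up to one, the same number: order all remaining messages by the node that holds them and then by an internal order of that node, and send the message at position $p$ to node $p \bmod n$. \item Each node announces to each node the number of messages for it that it holds. \item Each node announces the total number of remaining messages destined for it to all nodes. \item Let $M_r'$ be the maximum number of messages that any node still needs to receive, and let $k=\max\{\lfloor n/M_r'\rfloor,1\}$. Each node creates $k$ copies of each message it holds. Independently of the other nodes, it sends these copies to nodes according to a uniformly random assignment among those that send, up to one, the same number of copies over each of its links. \item Each node $w$ forwards to each node $v$ up to $3\lceil M_r'/n\rceil$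 of the copies of messages for $v$ that it has received in Step 5 (exactly that many, or all of them if there are fewer; any choice is allowed), and confirms each delivery to the node from which it received the copy. \item Each node deletes the messages for which it has received confirmations, and all copies. \end{enumerate} Steps 1, 3 and 4 take one round each. Steps 2 and 5 take as many rounds as the maximum number of messages to be sent over a single link in that step. Step 6 takes $3\lceil M_r'/n\rceil$ rounds for forwarding and, for the confirmations, as many rounds as Step 5. Let $\log^* x$ be the least $k\in\mathbb N_0$ such that the tower of twos of height $k$ (which is $1$ for $k=0$) is at least $x$. \textbf{Theorem.} For every constant $c>0$ there is a constant $C>0$ such that for every $n\ge 1$, every instance of the information distribution task on $n$ nodes, and every rule for the choices in Step 6 (which may even depend on the whole execution so far), the following holds with probability at least $1-n^{-c}$: $\mathcal A_g$ terminates after at most \[ C\left(\frac{M_s+M_r}{n}+\Big(\log^* n-\log^*\frac{n}{M_r}\Big)+1\right) \] rounds, and then each node $v$ has received exactly the messages in $\mathcal R_v$. (If $M_r=0$, then $\log^*(n/M_r)$ is read as $0$.) -/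

import Mathlib

/-! ### The iterated logarithm -/

/-- The tower `2 ^ (2 ^ (⋯ ^ 2))` of height `k`, with value `1` for `k = 0`. -/
def tower : ℕ → ℕ
  | 0 => 1
  | k + 1 => 2 ^ tower k

/-- `log* x`: the least `k` such that the tower of twos of height `k` is at least `x`
(equivalently, how often `log₂` has to be applied to `x` until the value is at most `1`). -/
noncomputable def logStar (x : ℝ) : ℕ :=
  sInf {k : ℕ | x ≤ (tower k : ℝ)}

/-! ### The information distribution task -/

/-- An instance of the information distribution task on the nodes `Fin n`: node `v` is given
`numMsgs v` messages, and its `i`-th message has the destination `dest v i`. -/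
structure IDT (n : ℕ) where
  numMsgs : Fin n → ℕ
  dest : (v : Fin n) → Fin (numMsgs v) → Fin n

namespace IDT

variable {n : ℕ}

/-- The messages of the instance; `⟨v, i⟩` is the `i`-th message given to node `v`. -/
abbrev Msg (I : IDT n) : Type := Σ v : Fin n, Fin (I.numMsgs v)

/-- The destination of a message. -/
def target (I : IDT n) (m : I.Msg) : Fin n := I.dest m.1 m.2

/-- The set `S_v` of messages given to node `v`. -/
def toSend (I : IDT n) (v : Fin n) : Finset I.Msg :=
  Finset.univ.filter fun m => m.1 = v

/-- The set `R_v` of messages that node `v` shall receive. -/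
def toReceive (I : IDT n) (v : Fin n) : Finset I.Msg :=
  Finset.univ.filter fun m => I.target m = v

/-- `M_s`, the maximum number of messages that a node has to send. -/
def maxSend (I : IDT n) : ℕ := Finset.univ.sup fun v => (I.toSend v).card

/-- `M_r`, the maximum number of messages that a node has to receive. -/
def maxReceive (I : IDT n) : ℕ := Finset.univ.sup fun v => (I.toReceive v).card

/-- The order of the messages by origin and then by index, which nodes use as their internal
order of the messages they hold. -/
def before {I : IDT n} (m m' : I.Msg) : Prop :=
  m.1 < m'.1 ∨ (m.1 = m'.1 ∧ (m.2 : ℕ) < (m'.2 : ℕ))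

end IDT

/-! ### Communication in the complete graph

In a round each node sends at most one message to each node (including itself), i.e. every
directed link carries one message per round. -/

/-- The number of rounds of a communication step in which `load u w` messages have to be sent
from `u` to `w`, for all nodes `u` and `w`: the maximum load of a link. -/
def linkRounds {n : ℕ} (load : Fin n → Fin n → ℕ) : ℕ :=
  Finset.univ.sup fun u => Finset.univ.sup fun w => load u w

/-! ### The algorithm -/

/-- The assignment `f` of finitely many items to the `n` nodes gives all nodes, up to one, the
same number of items. -/
def EvenlySpread {α : Type} [Fintype α] {n : ℕ} (f : α → Fin n) : Prop :=
  ∀ w w' : Fin n,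
    (Finset.univ.filter fun a => f a = w).card ≤ (Finset.univ.filter fun a => f a = w').card + 1

theorem exists_evenlySpread (α : Type) [Fintype α] (n : ℕ) [NeZero n] :
    ∃ f : α → Fin n, EvenlySpread f := by
  classical
  have hn : 0 < n := Nat.pos_of_ne_zero (NeZero.ne n)
  let e := Fintype.equivFin α
  refine ⟨fun a => ⟨(e a : ℕ) % n, Nat.mod_lt _ hn⟩, ?_⟩
  have key : ∀ w : Fin n,
      (Finset.univ.filter fun a => (⟨(e a : ℕ) % n, Nat.mod_lt _ hn⟩ : Fin n) = w).card
        = Nat.count (· ≡ (w : ℕ) [MOD n]) (Fintype.card α) := by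
    intro w
    rw [Nat.count_eq_card_filter_range]
    refine Finset.card_bij (fun a _ => (e a : ℕ)) ?_ ?_ ?_
    · intro a ha
      simp only [Finset.mem_filter, Finset.mem_univ, true_and, Fin.ext_iff] at ha
      simp only [Finset.mem_filter, Finset.mem_range, Fin.is_lt, true_and]
      rw [Nat.ModEq, ha, Nat.mod_eq_of_lt w.2]
    · intro a _ b _ hab
      exact e.injective (Fin.ext hab)
    · intro b hb
      simp only [Finset.mem_filter, Finset.mem_range] at hb
      refine ⟨e.symm ⟨b, hb.1⟩, ?_, by simp⟩
      simp only [Finset.mem_filter, Finset.mem_univ, true_and, Fin.ext_iff,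
        Equiv.apply_symm_apply]
      rw [hb.2, Nat.mod_eq_of_lt w.2]
  intro w w'
  rw [key, key, Nat.count_modEq_card _ hn, Nat.count_modEq_card _ hn]
  split_ifs <;> omega

namespace Ag

variable {n : ℕ} {I : IDT n}

/-- Which node currently holds which message; `none` stands for a message that has been
deleted because its delivery was confirmed. -/
abbrev Holding (I : IDT n) : Type := I.Msg → Option (Fin n)

/-- The number of messages that precede `m` when all remaining messages are ordered by the node
that holds them and then by that node's internal order. A node can compute it for its own
messages as soon as it knows how many messages every node holds. -/
noncomputable def position (H : Holding I) (m : I.Msg) : ℕ := by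
  classical
  exact (Finset.univ.filter fun m' : I.Msg => ∃ u u' : Fin n, H m = some u ∧ H m' = some u' ∧
    (u' < u ∨ (u' = u ∧ IDT.before m' m))).card

/-- Redistribution of the messages (Step 2): the remaining message at position `p` is sent to
node `p mod n`. -/
noncomputable def redistribute [NeZero n] (H : Holding I) : Holding I :=
  fun m => (H m).map fun _ => Fin.ofNat n (position H m)

/-- The number of rounds of Step 2. -/
noncomputable def redistributeRounds [NeZero n] (H : Holding I) : ℕ := by
  classical
  exact linkRounds fun u w : Fin n =>
    (Finset.univ.filter fun m : I.Msg => H m = some u ∧ redistribute H m = some w).card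

/-- `M_r'`: the maximum number of messages that a node still needs to receive. All nodes know
this number after Steps 3 and 4. -/
noncomputable def remaining (H : Holding I) : ℕ := by
  classical
  exact Finset.univ.sup fun v : Fin n =>
    (Finset.univ.filter fun m : I.Msg => H m ≠ none ∧ I.target m = v).card

/-- The number `k = max {⌊n / M_r'⌋, 1}` of copies that are created of each message. -/
noncomputable def numCopies (H : Holding I) : ℕ := max (n / remaining H) 1

/-- The maximum number `3 ⌈M_r' / n⌉` of copies that a node forwards to a node in Step 6. -/
noncomputable def capacity (H : Holding I) : ℕ := 3 * (remaining H ⌈/⌉ n)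

/-- The copies created by node `u` in Step 5: `(m, j)` is the `j`-th copy of the message `m`,
which `u` holds. -/
abbrev CopiesOf (H : Holding I) (u : Fin n) : Type :=
  {m : I.Msg // H m = some u} × Fin (numCopies H)

/-- The outcomes of the random choices of Step 5. Node `u` sends its copy `c` to the node
`F u c`, where over each link `u` sends, up to one, the same number of copies. The uniform
distribution on this product means that the nodes choose independently, each one uniformly from
its balanced assignments. -/
abbrev Scatter (H : Holding I) : Type :=
  (u : Fin n) → {f : CopiesOf H u → Fin n // EvenlySpread f}

noncomputable instance (H : Holding I) : Fintype (Scatter H) := by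
  classical
  infer_instance

instance [NeZero n] (H : Holding I) : Nonempty (Scatter H) :=
  ⟨fun u => ⟨(exists_evenlySpread (CopiesOf H u) n).choose,
    (exists_evenlySpread (CopiesOf H u) n).choose_spec⟩⟩

/-- The number of rounds of Step 5. -/
noncomputable def scatterRounds (H : Holding I) (F : Scatter H) : ℕ :=
  linkRounds fun u w => (Finset.univ.filter fun c => (F u).1 c = w).card

/-- The copies that node `w` receives in Step 5, as pairs of a message and the number of the
copy. -/
noncomputable def arrivals (H : Holding I) (F : Scatter H) (w : Fin n) :
    Finset (I.Msg × ℕ) := by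
  classical
  exact (Finset.univ ×ˢ Finset.range (numCopies H)).filter fun c =>
    ∃ (u : Fin n) (hu : H c.1 = some u) (hj : c.2 < numCopies H),
      (F u).1 (⟨c.1, hu⟩, ⟨c.2, hj⟩) = w

/-- For each phase that has been executed, the copies that each node received in Step 5 of that
phase, the latest phase first. For a given forwarding rule it determines everything that has happened so
far. -/
abbrev History (I : IDT n) : Type := List (Fin n → Finset (I.Msg × ℕ))

/-- A rule for the choices left open in Step 6. If node `w` has the set `A` of copies of
messages for node `v` and may forward up to `L` of them, it forwards the set
`choose h w v A L`, which consists of `L` copies, or of all of them if there are at most `L`.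
The choice may depend in any way on the whole execution `h` up to and including Step 5 of the
current phase. -/
structure ForwardRule (I : IDT n) where
  choose : History I → Fin n → Fin n → Finset (I.Msg × ℕ) → ℕ → Finset (I.Msg × ℕ)
  choose_subset : ∀ h w v A L, choose h w v A L ⊆ A
  choose_card : ∀ h w v A L, (choose h w v A L).card = min A.card L

/-- The state between two phases. `received v` is the set of messages of which a copy was
forwarded to `v` in Step 6 of some phase, `rounds` is the number of rounds so far, and `halted`
tells whether the algorithm has terminated. -/
structure State (I : IDT n) where
  holding : Holding I
  received : Fin n → Finset I.Msg
  rounds : ℕ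
  halted : Bool
  history : History I

/-- Initially each node holds the messages that it was given. -/
def initial (I : IDT n) : State I where
  holding := fun m => some m.1
  received := fun _ => ∅
  rounds := 0
  halted := false
  history := []

/-- The copies that node `w` forwards to node `v` in Step 6. -/
noncomputable def forwarded (rule : ForwardRule I) (h : History I) (H : Holding I)
    (F : Scatter H) (w v : Fin n) : Finset (I.Msg × ℕ) :=
  rule.choose ((arrivals H F) :: h) w v
    ((arrivals H F w).filter fun c => I.target c.1 = v) (capacity H)

/-- Steps 5 to 7, for the holding `H` after Step 2 and the random choices `F`. A node `v`
keeps the copies that are forwarded to it; the relaying node `w` confirms the delivery to the node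
from which it got the copy, and that node deletes the message. All other copies are deleted.

Rounds: Step 1, Step 3 and Step 4 take one round each, since every node sends one number over
every link. For forwarding, the nodes reserve `capacity H` rounds, as they do not know how many
are needed. The confirmations travel over the links of Step 5 in the opposite direction, at most
one for each copy, and get as many rounds as Step 5. -/
noncomputable def finishPhase [NeZero n] (rule : ForwardRule I) (s : State I) (H : Holding I)
    (F : Scatter H) : State I := by
  classical
  exact
    { holding := fun m => if ∃ w v j, (m, j) ∈ forwarded rule s.history H F w v then none else H m
      received := fun v => s.received v ∪
        Finset.univ.biUnion fun w => (forwarded rule s.history H F w v).image Prod.fst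
      rounds := s.rounds
        + 1                                -- Step 1
        + redistributeRounds s.holding     -- Step 2
        + 1                                -- Step 3
        + 1                                -- Step 4
        + scatterRounds H F                -- Step 5
        + capacity H                       -- Step 6, forwarding
        + scatterRounds H F                -- Step 6, confirmations
      halted := false
      history := (arrivals H F) :: s.history }

/-- One phase, i.e. one execution of the loop. If Step 1 shows that no node has any messages
left, then the algorithm terminates after this round; otherwise Steps 2 to 7 are executed. -/
noncomputable def phase [NeZero n] (rule : ForwardRule I) (s : State I) : PMF (State I) := by
  classical
  exact
    if s.halted = true then PMF.pure s
    else if ∀ m, s.holding m = none then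
      PMF.pure { s with rounds := s.rounds + 1, halted := true }
    else
      (PMF.uniformOfFintype (Scatter (redistribute s.holding))).map
        (finishPhase rule s (redistribute s.holding))

/-- The distribution of the state after `t` phases. -/
noncomputable def run [NeZero n] (rule : ForwardRule I) : ℕ → PMF (State I)
  | 0 => PMF.pure (initial I)
  | t + 1 => (run rule t).bind (phase rule)

/-- The algorithm has terminated after at most `B` rounds, and each node has received exactly
the messages destined for it. -/
def SolvedWithin (B : ℝ) (s : State I) : Prop :=
  s.halted = true ∧ (s.rounds : ℝ) ≤ B ∧ ∀ v, s.received v = I.toReceive v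

/-- The probability that the algorithm terminates after at most `B` rounds with all messages
delivered. Since each phase takes at least one round and a terminated execution does not change
any more, it suffices to look at the state after `⌊B⌋` phases. -/
noncomputable def probSolvedWithin [NeZero n] (rule : ForwardRule I) (B : ℝ) : ENNReal :=
  (run rule ⌊B⌋₊).toOuterMeasure {s | SolvedWithin B s}

end Ag

/-! Write `M` for the current `M_r'`. In Step 5 there are at most `⌈M/n⌉ * n` copies of messages for
a given destination `v`, so an average relay receives at most `⌈M/n⌉` of them. A relay that receives
at most three times as many forwards them all, whatever the rule of Step 6 is. Hence a message
survives a phase only if each of its copies reaches an overfull relay.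

Balanced random assignments are negatively correlated: a set `S` of copies lands inside a set `W` of
relays with probability at most `(|W|/n)^|S|` (`card_evenlySpread_mapsTo_mul_le`,
`negCorrelated_scatterLoc`). This is all that a Chernoff bound with the moments `3^X` needs,
followed by a union bound over the possible sets `W` of overfull relays. With high probability, a
phase that starts with at least `κ` copies per message has these effects. (a) The copies in excess
of the capacities number at most `n/3` for each destination, so that `3κM' ≤ n` for the new maximum
`M'` (`card_lt_three_mul_remaining_le`). (b) If `Mκ ≤ n`, then `b` given messages all survive with
probability about `(3/4)^(κb)`. This beats the number of choices of `b` messages, so `M'κ' ≤ n` for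
`κ'` exponential in `κ` (`card_lt_remaining_mul_le`). (c) If `κ` is of order `√n`, nothing survives
(`card_remaining_pos_le_of_mul_le`).

One phase of type (a) brings `M` below `n`, and three more make `κ = 81` available. Two phases of
type (b) climb at least one level of the tower of twos. Since `M_r * tower (log*(n/M_r) - 1) ≤ n` in
the relevant case, about `2(log* n - log*(n/M_r))` phases raise `κ` to order `√n`, and (c) finishes
(`holdsAfter_of_large`).

For the running time, the potential "rounds so far plus messages held by a node divided by `n`"
grows by at most `9 + 6M/n` per phase (`rounds_finishPhase_le`). For bounded `n` the probability
bounds are too weak, but either `M_r/n` is large and one phase suffices with the required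
probability, or `M_r` is bounded and the deterministic decrease of `M` by at least one per phase is
enough. -/

/-! ### Balanced assignments are negatively correlated -/

section Balanced

variable {α : Type} [Fintype α] [DecidableEq α] {n : ℕ}

/-- The number of items that `f` assigns to `w`. -/
def fiberCard (f : α → Fin n) (w : Fin n) : ℕ := (Finset.univ.filter fun x => f x = w).card

/-- Replace the value `a` of `f` at `x₀` by `b`, and the value `b` by `a` outside `R`. -/
def recolor (f : α → Fin n) (x₀ : α) (a b : Fin n) (R : Finset α) : α → Fin n :=
  fun x => if x = x₀ then b else if f x = b ∧ x ∉ R then a else f x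

/-- The size of `R` is chosen so that recoloring exchanges the loads of `a` and `b`: the new
`b`-fibre is `R` together with `x₀`, and the rest of the old `b`-fibre joins the `a`-fibre. -/
theorem fiberCard_recolor_left {f : α → Fin n} {x₀ : α} {a b : Fin n} {R : Finset α}
    (hab : a ≠ b) (hx : f x₀ = a) (hR : R ⊆ Finset.univ.filter fun x => f x = b)
    (hc : R.card = fiberCard f a - 1) : fiberCard (recolor f x₀ a b R) a = fiberCard f b := by
  have h1 : (Finset.univ.filter fun x => recolor f x₀ a b R x = a)
      = ((Finset.univ.filter fun x => f x = a).erase x₀) ∪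
        ((Finset.univ.filter fun x => f x = b) \ R) := by
    ext x
    simp only [Finset.mem_filter, Finset.mem_univ, true_and, Finset.mem_union,
      Finset.mem_erase, Finset.mem_sdiff]
    unfold recolor
    by_cases hxx : x = x₀
    · subst hxx; simp [hab.symm, hx, hab]
    · by_cases hb : f x = b
      · by_cases hr : x ∈ R <;> simp [hxx, hb, hr, hab.symm]
      · simp [hxx, hb]
  have hd : Disjoint ((Finset.univ.filter fun x => f x = a).erase x₀)
        ((Finset.univ.filter fun x => f x = b) \ R) := by
    rw [Finset.disjoint_left]
    intro x h h'
    simp only [Finset.mem_filter, Finset.mem_univ, true_and, Finset.mem_erase,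
      Finset.mem_sdiff] at h h'
    exact hab (h.2.symm.trans h'.1)
  have hle := Finset.card_le_card hR
  unfold fiberCard at *
  rw [h1, Finset.card_union_of_disjoint hd, Finset.card_erase_of_mem (by simp [hx]),
    Finset.card_sdiff_of_subset hR]
  omega

theorem fiberCard_recolor_right {f : α → Fin n} {x₀ : α} {a b : Fin n} {R : Finset α}
    (hab : a ≠ b) (hx : f x₀ = a) (hR : R ⊆ Finset.univ.filter fun x => f x = b)
    (hc : R.card = fiberCard f a - 1) : fiberCard (recolor f x₀ a b R) b = fiberCard f a := by
  have hxR : x₀ ∉ R := fun h => by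
    have := hR h
    simp only [Finset.mem_filter, Finset.mem_univ, true_and] at this
    exact hab (hx.symm.trans this)
  have h1 : (Finset.univ.filter fun x => recolor f x₀ a b R x = b) = insert x₀ R := by
    ext x
    simp only [Finset.mem_filter, Finset.mem_univ, true_and, Finset.mem_insert]
    unfold recolor
    by_cases hxx : x = x₀
    · simp [hxx]
    · by_cases hb : f x = b
      · by_cases hr : x ∈ R <;> simp [hxx, hb, hr, hab]
      · have : x ∉ R := fun h => hb (by simpa using hR h)
        simp [hxx, hb, this]
  have hpos : 0 < fiberCard f a := Finset.card_pos.2 ⟨x₀, by simp [hx]⟩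
  unfold fiberCard at *
  rw [h1, Finset.card_insert_of_notMem hxR]
  omega

theorem fiberCard_recolor_of_ne {f : α → Fin n} {x₀ : α} {a b w : Fin n} {R : Finset α}
    (hx : f x₀ = a) (ha : w ≠ a) (hb : w ≠ b) :
    fiberCard (recolor f x₀ a b R) w = fiberCard f w := by
  unfold fiberCard
  congr 1
  ext x
  simp only [Finset.mem_filter, Finset.mem_univ, true_and]
  unfold recolor
  by_cases hxx : x = x₀
  · subst hxx; simp [hx, hb.symm, ha.symm]
  · by_cases h : f x = b
    · by_cases hr : x ∈ R <;> simp [hxx, h, hr, hb.symm, ha.symm]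
    · simp [hxx, h]

theorem EvenlySpread.recolor {f : α → Fin n} {x₀ : α} {a b : Fin n} {R : Finset α}
    (hf : EvenlySpread f) (hab : a ≠ b) (hx : f x₀ = a)
    (hR : R ⊆ Finset.univ.filter fun x => f x = b)
    (hc : R.card = fiberCard f a - 1) : EvenlySpread (recolor f x₀ a b R) := by
  have hf' : ∀ w w', fiberCard f w ≤ fiberCard f w' + 1 := hf
  have key : ∀ w, fiberCard (_root_.recolor f x₀ a b R) w = fiberCard f (Equiv.swap a b w) := by
    intro w
    by_cases hwa : w = a
    · subst hwa; rw [Equiv.swap_apply_left, fiberCard_recolor_left hab hx hR hc]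
    · by_cases hwb : w = b
      · subst hwb; rw [Equiv.swap_apply_right, fiberCard_recolor_right hab hx hR hc]
      · rw [Equiv.swap_apply_of_ne_of_ne hwa hwb, fiberCard_recolor_of_ne hx hwa hwb]
  intro w w'
  have := hf' (Equiv.swap a b w) (Equiv.swap a b w')
  rw [← key, ← key] at this
  exact this

/-- Double counting in the bipartite graph that joins `f` to its recolorings. Recoloring only moves
`x₀` and items with value `b ∉ W`, so the constraint on `S` survives. Because the loads of `a` and
`b` are exchanged, the degree of `f` equals the upper bound for the degree of each of its
neighbours. -/
theorem card_evenlySpread_le_of_mem_of_notMem [DecidablePred (EvenlySpread (α := α) (n := n))]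
    {S : Finset α} {W : Finset (Fin n)} {x₀ : α} (hx₀ : x₀ ∉ S) {a b : Fin n} (ha : a ∈ W)
    (hb : b ∉ W) :
    (Finset.univ.filter fun f : α → Fin n =>
        (EvenlySpread f ∧ ∀ x ∈ S, f x ∈ W) ∧ f x₀ = a).card ≤
      (Finset.univ.filter fun f : α → Fin n =>
        (EvenlySpread f ∧ ∀ x ∈ S, f x ∈ W) ∧ f x₀ = b).card := by
  classical
  have hab : a ≠ b := fun h => hb (h ▸ ha)
  set A := Finset.univ.filter fun f : α → Fin n =>
        (EvenlySpread f ∧ ∀ x ∈ S, f x ∈ W) ∧ f x₀ = a with hA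
  set B := Finset.univ.filter fun f : α → Fin n =>
        (EvenlySpread f ∧ ∀ x ∈ S, f x ∈ W) ∧ f x₀ = b with hB
  let r : (α → Fin n) → (α → Fin n) → Prop := fun f g =>
    ∃ R : Finset α, R ⊆ (Finset.univ.filter fun x => f x = b) ∧ R.card = fiberCard f a - 1 ∧
      g = recolor f x₀ a b R
  let d : (α → Fin n) → ℕ := fun f => (fiberCard f b).choose (fiberCard f a - 1)
  let d' : (α → Fin n) → ℕ := fun f => (fiberCard f a).choose (fiberCard f b - 1)
  have hdd : ∀ f ∈ A, ∀ g, r f g → d f = d' g := by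
    rintro f hf g ⟨R, hR, hc, rfl⟩
    have hx : f x₀ = a := (Finset.mem_filter.1 hf).2.2
    simp only [d, d']
    rw [fiberCard_recolor_left hab hx hR hc, fiberCard_recolor_right hab hx hR hc]
  have hpos : ∀ f ∈ A, 0 < d f := by
    intro f hf
    -- Evenness of `f` is what makes room for a set `R` of the required size inside the `b`-fibre.
    have he : fiberCard f a ≤ fiberCard f b + 1 := (Finset.mem_filter.1 hf).2.1.1 a b
    exact Nat.choose_pos (by omega)
  have hdeg : ∀ f ∈ A, d f ≤ (B.filter (r f)).card := by
    intro f hf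
    obtain ⟨⟨he, hS⟩, hx⟩ := (Finset.mem_filter.1 hf).2
    have : d f = ((Finset.univ.filter fun x => f x = b).powersetCard (fiberCard f a - 1)).card := by
      rw [Finset.card_powersetCard]; rfl
    rw [this]
    refine Finset.card_le_card_of_injOn (fun R => recolor f x₀ a b R) ?_ ?_
    · intro R hR
      obtain ⟨hR, hc⟩ := Finset.mem_powersetCard.1 hR
      simp only [Finset.coe_filter, Set.mem_ofPred_eq, hB, Finset.mem_filter, Finset.mem_univ,
        true_and]
      refine ⟨⟨⟨he.recolor hab hx hR hc, fun x hxS => ?_⟩, by simp [recolor]⟩, R, hR, hc, rfl⟩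
      have h1 : x ≠ x₀ := fun h => hx₀ (h ▸ hxS)
      have h2 : f x ≠ b := fun h => hb (h ▸ hS x hxS)
      simpa [recolor, h1, h2] using hS x hxS
    · intro R hR R' hR' h
      obtain ⟨hR, -⟩ := Finset.mem_powersetCard.1 hR
      obtain ⟨hR', -⟩ := Finset.mem_powersetCard.1 hR'
      have key : ∀ R : Finset α, R ⊆ (Finset.univ.filter fun x => f x = b) →
          R = (Finset.univ.filter fun x => recolor f x₀ a b R x = b).erase x₀ := by
        intro R hR
        ext x
        simp only [Finset.mem_erase, Finset.mem_filter, Finset.mem_univ, true_and]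
        unfold recolor
        by_cases hr : x ∈ R
        · have h1 : f x = b := by simpa using hR hr
          have h2 : x ≠ x₀ := fun h => hab (by rw [← hx, ← h, h1])
          simp [h1, h2, hr]
        · by_cases h1 : x = x₀
          · simp only [h1, h1 ▸ hr, ne_eq, not_true_eq_false, false_and]
          · by_cases h2 : f x = b <;> simp [hr, h1, h2, hab]
      rw [key R hR, key R' hR']
      simp only at h
      rw [h]
  have hdeg' : ∀ g ∈ B, (A.filter (r · g)).card ≤ d' g := by
    intro g hg
    obtain ⟨⟨he, hS⟩, hx⟩ := (Finset.mem_filter.1 hg).2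
    have : d' g = ((Finset.univ.filter fun x => g x = a).powersetCard (fiberCard g b - 1)).card := by
      rw [Finset.card_powersetCard]; rfl
    rw [this]
    -- Outside `x₀`, a preimage `f` agrees with `g` except where `g` is `a`, and there it is `a` or
    -- `b`. So the `a`-fibre of `f` without `x₀` determines `f`.
    have spec : ∀ f ∈ A.filter (r · g), f x₀ = a ∧
        ∀ x, x ≠ x₀ → (f x = a → g x = a) ∧ (g x = a → f x = a ∨ f x = b) ∧
          (g x ≠ a → f x = g x) := by
      intro f hf
      obtain ⟨hfA, R, hR, hc, rfl⟩ := Finset.mem_filter.1 hf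
      refine ⟨(Finset.mem_filter.1 hfA).2.2, fun x hxx => ?_⟩
      simp only [recolor, hxx, if_false]
      by_cases h : f x = b
      · by_cases hr : x ∈ R <;> simp [h, hr, hab.symm]
      · simp [h]
    refine Finset.card_le_card_of_injOn
      (fun f => (Finset.univ.filter fun x => f x = a).erase x₀) ?_ ?_
    · intro f hf
      have hs := spec f hf
      obtain ⟨hf, R, hR, hc, rfl⟩ := Finset.mem_filter.1 hf
      rw [Finset.mem_coe, Finset.mem_powersetCard]
      constructor
      · intro x hxm
        simp only [Finset.mem_erase, Finset.mem_filter, Finset.mem_univ, true_and] at hxm ⊢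
        exact (hs.2 x hxm.1).1 hxm.2
      · rw [Finset.card_erase_of_mem (by simp [hs.1]), fiberCard_recolor_right hab hs.1 hR hc]
        rfl
    · intro f hf f' hf' h
      have hs := spec f hf
      have hs' := spec f' hf'
      funext x
      by_cases hxx : x = x₀
      · rw [hxx, hs.1, hs'.1]
      · have hiff : f x = a ↔ f' x = a := by
          have := Finset.ext_iff.1 h x
          simpa [hxx] using this
        obtain ⟨-, h2, h3⟩ := hs.2 x hxx
        obtain ⟨-, h2', h3'⟩ := hs'.2 x hxx
        by_cases hg : g x = a
        · rcases h2 hg with h | h <;> rcases h2' hg with h' | h'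
          · rw [h, h']
          · exact absurd ((hiff.1 h).symm.trans h') hab
          · exact absurd ((hiff.2 h').symm.trans h) hab
          · rw [h, h']
        · rw [h3 hg, h3' hg]
  -- Each edge gets weight `1 / d f`: every `f` then has weight at least `1` and every `g` at most
  -- `1`.
  have hcount : (A.card : ℚ) ≤ B.card := by
    calc (A.card : ℚ) = ∑ f ∈ A, 1 := by simp
      _ ≤ ∑ f ∈ A, ∑ g ∈ B.filter (r f), (1 : ℚ) / d f := by
          refine Finset.sum_le_sum fun f hf => ?_
          rw [Finset.sum_const, nsmul_eq_mul, mul_one_div,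
            le_div_iff₀ (by exact_mod_cast hpos f hf), one_mul]
          exact_mod_cast hdeg f hf
      _ = ∑ f ∈ A, ∑ g ∈ B, if r f g then (1 : ℚ) / d' g else 0 := by
          refine Finset.sum_congr rfl fun f hf => ?_
          rw [Finset.sum_filter]
          refine Finset.sum_congr rfl fun g _ => ?_
          split_ifs with h
          · rw [hdd f hf g h]
          · rfl
      _ = ∑ g ∈ B, ∑ f ∈ A.filter (r · g), (1 : ℚ) / d' g := by
          rw [Finset.sum_comm]
          exact Finset.sum_congr rfl fun g _ => (Finset.sum_filter _ _).symm
      _ ≤ ∑ g ∈ B, 1 := by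
          refine Finset.sum_le_sum fun g hg => ?_
          rw [Finset.sum_const, nsmul_eq_mul, mul_one_div]
          exact div_le_one_of_le₀ (by exact_mod_cast hdeg' g hg) (by positivity)
      _ = B.card := by simp
  exact_mod_cast hcount

/-- Given that `S` is mapped into `W`, every value in `W` is at most as likely for a further item as
every value outside `W`. So that item lands in `W` with conditional probability at most `|W|/n`, and
induction on `S` multiplies these factors. -/
theorem card_evenlySpread_mapsTo_mul_le [DecidablePred (EvenlySpread (α := α) (n := n))]
    (S : Finset α) (W : Finset (Fin n)) :
    (Finset.univ.filter fun f : α → Fin n => EvenlySpread f ∧ ∀ x ∈ S, f x ∈ W).card * n ^ S.card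
      ≤ (Finset.univ.filter fun f : α → Fin n => EvenlySpread f).card * W.card ^ S.card := by
  classical
  induction S using Finset.induction_on with
  | empty => simp
  | insert x₀ S hx ih =>
    set E := Finset.univ.filter fun f : α → Fin n => EvenlySpread f ∧ ∀ x ∈ S, f x ∈ W with hE
    let N : Fin n → ℕ := fun a => (E.filter fun f => f x₀ = a).card
    have hN : ∀ a ∈ W, ∀ b ∈ Wᶜ, N a ≤ N b := by
      intro a ha b hb
      have := card_evenlySpread_le_of_mem_of_notMem hx ha (Finset.mem_compl.1 hb)
      simpa only [N, hE, Finset.filter_filter] using this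
    have hin : (Finset.univ.filter fun f : α → Fin n =>
        EvenlySpread f ∧ ∀ x ∈ insert x₀ S, f x ∈ W).card = ∑ a ∈ W, N a := by
      rw [Finset.card_eq_sum_card_fiberwise (f := fun f => f x₀) (t := W)]
      · refine Finset.sum_congr rfl fun a ha => ?_
        congr 1
        ext f
        simp only [hE, Finset.mem_filter, Finset.mem_univ, true_and, Finset.forall_mem_insert]
        constructor
        · rintro ⟨⟨h1, h2, h3⟩, h4⟩; exact ⟨⟨h1, h3⟩, h4⟩
        · rintro ⟨⟨h1, h3⟩, h4⟩; exact ⟨⟨h1, h4 ▸ ha, h3⟩, h4⟩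
      · intro f hf
        simp only [Finset.coe_filter, Finset.mem_univ, true_and, Finset.forall_mem_insert,
          Set.mem_ofPred_eq] at hf
        exact hf.2.1
    have hall : E.card = ∑ a ∈ W, N a + ∑ b ∈ Wᶜ, N b := by
      rw [Finset.sum_add_sum_compl,
        Finset.card_eq_sum_card_fiberwise (f := fun f => f x₀) (t := Finset.univ)]
      intro f _; simp
    have hcross : Wᶜ.card * ∑ a ∈ W, N a ≤ W.card * ∑ b ∈ Wᶜ, N b := by
      calc Wᶜ.card * ∑ a ∈ W, N a = ∑ a ∈ W, ∑ b ∈ Wᶜ, N a := by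
            simp [Finset.mul_sum]
        _ ≤ ∑ a ∈ W, ∑ b ∈ Wᶜ, N b :=
            Finset.sum_le_sum fun a ha => Finset.sum_le_sum fun b hb => hN a ha b hb
        _ = W.card * ∑ b ∈ Wᶜ, N b := by simp
    have hn : W.card + Wᶜ.card = n := by
      rw [Finset.card_add_card_compl, Fintype.card_fin]
    have hstep : (∑ a ∈ W, N a) * n ≤ E.card * W.card := by
      rw [hall]; nlinarith
    rw [hin, Finset.card_insert_of_notMem hx]
    calc (∑ a ∈ W, N a) * n ^ (S.card + 1) = (∑ a ∈ W, N a) * n * n ^ S.card := by ring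
      _ ≤ E.card * W.card * n ^ S.card := Nat.mul_le_mul_right _ hstep
      _ = E.card * n ^ S.card * W.card := by ring
      _ ≤ _ * W.card ^ S.card * W.card := Nat.mul_le_mul_right _ ih
      _ = _ := by ring

end Balanced

/-! ### Occupancy of bins under negatively correlated placements -/

section Occupancy

open Real

variable {Ω Γ : Type} {n : ℕ}

/-- The number of items of `D` in bin `w`. -/
def binLoad (loc : Ω → Γ → Fin n) (D : Finset Γ) (ω : Ω) (w : Fin n) : ℕ :=
  (D.filter fun γ => loc ω γ = w).card

theorem card_filter_mem_eq_sum_binLoad (loc : Ω → Γ → Fin n) (D : Finset Γ)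
    (W : Finset (Fin n)) (ω : Ω) :
    (D.filter fun γ => loc ω γ ∈ W).card = ∑ w ∈ W, binLoad loc D ω w := by
  rw [Finset.card_eq_sum_card_fiberwise (s := D.filter fun γ => loc ω γ ∈ W) (f := loc ω) (t := W)
    (fun γ hγ => (Finset.mem_filter.1 (Finset.mem_coe.1 hγ)).2)]
  refine Finset.sum_congr rfl fun w hw => ?_
  unfold binLoad
  congr 1
  ext γ
  simp only [Finset.mem_filter]
  constructor
  · rintro ⟨⟨h1, -⟩, h2⟩; exact ⟨h1, h2⟩
  · rintro ⟨h1, h2⟩; exact ⟨⟨h1, h2 ▸ hw⟩, h2⟩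

variable [Fintype Ω]

/-- For a uniformly random `ω : Ω`, the probability that the items in `S` all are placed in the
set `W` of bins is at most what it would be for independent uniform placements. -/
def NegCorrelated (loc : Ω → Γ → Fin n) : Prop :=
  ∀ (S : Finset Γ) (W : Finset (Fin n)),
    ((Finset.univ.filter fun ω => ∀ γ ∈ S, loc ω γ ∈ W).card : ℝ)
      ≤ Fintype.card Ω * ((W.card : ℝ) / n) ^ S.card

variable [DecidableEq Γ] {loc : Ω → Γ → Fin n} {D T : Finset Γ} {W : Finset (Fin n)}

/-- An item contributes the factor `1 + 2 * indicator`. Expanding the product over `D \ T` gives a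
nonnegative combination of events "`T ∪ S` lands in `W`", to which negative correlation applies term
by term. -/
theorem NegCorrelated.sum_three_pow_le (h : NegCorrelated loc) (hT : T ⊆ D) :
    (∑ ω, if ∀ γ ∈ T, loc ω γ ∈ W then (3 : ℝ) ^ (D.filter fun γ => loc ω γ ∈ W).card else 0)
      ≤ Fintype.card Ω * (3 * W.card / n) ^ T.card *
        (1 + 2 * W.card / n) ^ (D.card - T.card) := by
  have hpt : ∀ ω, (if ∀ γ ∈ T, loc ω γ ∈ W then
        (3 : ℝ) ^ (D.filter fun γ => loc ω γ ∈ W).card else 0)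
      = ∑ S ∈ (D \ T).powerset, (3 : ℝ) ^ T.card * (2 ^ S.card *
          if ∀ γ ∈ T ∪ S, loc ω γ ∈ W then 1 else 0) := by
    intro ω
    by_cases hω : ∀ γ ∈ T, loc ω γ ∈ W
    · rw [if_pos hω, ← Finset.mul_sum]
      have h1 : (D.filter fun γ => loc ω γ ∈ W).card
          = T.card + ((D \ T).filter fun γ => loc ω γ ∈ W).card := by
        rw [← Finset.card_union_of_disjoint]
        · congr 1
          ext γ
          simp only [Finset.mem_filter, Finset.mem_union, Finset.mem_sdiff]
          constructor
          · rintro ⟨a, b⟩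
            by_cases c : γ ∈ T
            · exact Or.inl c
            · exact Or.inr ⟨⟨a, c⟩, b⟩
          · rintro (a | ⟨⟨a, -⟩, b⟩)
            · exact ⟨hT a, hω γ a⟩
            · exact ⟨a, b⟩
        · exact Finset.disjoint_of_subset_right (Finset.filter_subset _ _)
            Finset.disjoint_sdiff
      rw [h1, pow_add]
      congr 1
      have h2 : (3 : ℝ) ^ ((D \ T).filter fun γ => loc ω γ ∈ W).card
          = ∏ γ ∈ D \ T, (1 + if loc ω γ ∈ W then (2 : ℝ) else 0) := by
        rw [← Finset.prod_const, Finset.prod_filter]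
        refine Finset.prod_congr rfl fun γ _ => ?_
        split_ifs <;> norm_num
      rw [h2, Finset.prod_one_add]
      refine Finset.sum_congr rfl fun S _ => ?_
      by_cases hS : ∀ γ ∈ S, loc ω γ ∈ W
      · rw [Finset.prod_congr rfl (fun γ hγ => if_pos (hS γ hγ)), Finset.prod_const, if_pos,
          mul_one]
        intro γ hγ
        rcases Finset.mem_union.1 hγ with hγ | hγ
        exacts [hω γ hγ, hS γ hγ]
      · rw [if_neg (fun hh => hS fun γ hγ => hh γ (Finset.mem_union_right _ hγ)), mul_zero]
        push Not at hS
        obtain ⟨γ, hγ, hγW⟩ := hS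
        exact Finset.prod_eq_zero hγ (if_neg hγW)
    · rw [if_neg hω]
      symm
      refine Finset.sum_eq_zero fun S _ => ?_
      rw [if_neg (fun hh => hω fun γ hγ => hh γ (Finset.mem_union_left _ hγ))]
      simp
  rw [Finset.sum_congr rfl fun ω _ => hpt ω, Finset.sum_comm]
  calc ∑ S ∈ (D \ T).powerset, ∑ ω, (3 : ℝ) ^ T.card * (2 ^ S.card *
          if ∀ γ ∈ T ∪ S, loc ω γ ∈ W then (1 : ℝ) else 0)
      ≤ ∑ S ∈ (D \ T).powerset, (3 : ℝ) ^ T.card * (2 ^ S.card *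
          (Fintype.card Ω * ((W.card : ℝ) / n) ^ (T.card + S.card))) := by
        refine Finset.sum_le_sum fun S hS => ?_
        rw [← Finset.mul_sum, ← Finset.mul_sum, Finset.sum_boole]
        have hd : Disjoint T S :=
          Finset.disjoint_of_subset_right (Finset.mem_powerset.1 hS) Finset.disjoint_sdiff
        have := h (T ∪ S) W
        rw [Finset.card_union_of_disjoint hd] at this
        gcongr
    _ = Fintype.card Ω * (3 * W.card / n) ^ T.card *
          ∑ S ∈ (D \ T).powerset, ∏ γ ∈ S, (2 * (W.card : ℝ) / n) := by
        rw [Finset.mul_sum]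
        refine Finset.sum_congr rfl fun S _ => ?_
        rw [Finset.prod_const, mul_div_assoc, mul_div_assoc, mul_pow, mul_pow, pow_add]
        ring
    _ = _ := by
        rw [← Finset.prod_one_add, Finset.prod_const, Finset.card_sdiff_of_subset hT]

/-- Markov's inequality for the moment `3^X`, restricted to the event that `T` lands in `W`. -/
theorem NegCorrelated.card_tail_le (h : NegCorrelated loc) (hT : T ⊆ D) {lam : ℕ}
    (hD : D.card ≤ lam * n) (r : ℕ) :
    ((Finset.univ.filter fun ω => (∀ γ ∈ T, loc ω γ ∈ W) ∧
        r ≤ (D.filter fun γ => loc ω γ ∈ W).card).card : ℝ)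
      ≤ Fintype.card Ω * (3 * W.card / n) ^ T.card * exp (2 * lam * W.card) / 3 ^ r := by
  rw [le_div_iff₀ (by positivity)]
  calc _ = ∑ ω, if (∀ γ ∈ T, loc ω γ ∈ W) ∧
          r ≤ (D.filter fun γ => loc ω γ ∈ W).card then (3 : ℝ) ^ r else 0 := by
        rw [← Finset.sum_filter, Finset.sum_const, nsmul_eq_mul]
    _ ≤ ∑ ω, if ∀ γ ∈ T, loc ω γ ∈ W then (3 : ℝ) ^ (D.filter fun γ => loc ω γ ∈ W).card
          else 0 := by
        refine Finset.sum_le_sum fun ω _ => ?_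
        by_cases h1 : ∀ γ ∈ T, loc ω γ ∈ W
        · by_cases h2 : r ≤ (D.filter fun γ => loc ω γ ∈ W).card
          · rw [if_pos ⟨h1, h2⟩, if_pos h1]
            exact pow_le_pow_right₀ (by norm_num) h2
          · rw [if_neg (fun hh => h2 hh.2), if_pos h1]
            positivity
        · rw [if_neg (fun hh => h1 hh.1), if_neg h1]
    _ ≤ _ := h.sum_three_pow_le hT
    _ ≤ _ := by
        gcongr
        rcases Nat.eq_zero_or_pos n with hn | hn
        · subst hn
          have : W = ∅ := Finset.eq_empty_of_isEmpty W
          simp [this]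
        calc (1 + 2 * (W.card : ℝ) / n) ^ (D.card - T.card)
            ≤ (exp (2 * (W.card : ℝ) / n)) ^ (D.card - T.card) := by
              gcongr
              rw [add_comm]
              exact add_one_le_exp _
          _ = exp ((D.card - T.card : ℕ) * (2 * (W.card : ℝ) / n)) := (exp_nat_mul _ _).symm
          _ ≤ _ := by
              rw [exp_le_exp]
              have h1 : ((D.card - T.card : ℕ) : ℝ) ≤ lam * n := by
                exact_mod_cast (Nat.sub_le _ _).trans hD
              calc ((D.card - T.card : ℕ) : ℝ) * (2 * (W.card : ℝ) / n)
                  ≤ (lam * n) * (2 * (W.card : ℝ) / n) := by gcongr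
                _ = _ := by field_simp

/-- `exp 2 / 27` to the power of `lam` bounds the relative frequency of bins with more than three
times the average load `lam`. -/
theorem exp_two_mul_div_pow (lam w : ℕ) :
    exp (2 * lam * w) / 3 ^ (3 * lam * w) = ((exp 2 / 27) ^ lam) ^ w := by
  have h : (2 * lam * w : ℝ) = (lam * w : ℕ) * 2 := by push_cast; ring
  rw [← pow_mul, div_pow, ← exp_nat_mul, mul_assoc 3 lam w, pow_mul 3 3, h]
  norm_num

/-- If the total excess is at least `b`, then the set `W` of bins with load at least `3 * lam` holds
at least `3 * lam * |W| + b` items. Summing the tail bound over all `W` gives a binomial expansion.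
-/
theorem NegCorrelated.card_excess_le (h : NegCorrelated loc) {lam : ℕ}
    (hD : D.card ≤ lam * n) (b : ℕ) :
    ((Finset.univ.filter fun ω => b ≤ ∑ w, (binLoad loc D ω w - 3 * lam)).card : ℝ)
      ≤ Fintype.card Ω * ((1 + (exp 2 / 27) ^ lam) ^ n / 3 ^ b) := by
  classical
  have hsub : (Finset.univ.filter fun ω => b ≤ ∑ w, (binLoad loc D ω w - 3 * lam)) ⊆
      (Finset.univ : Finset (Finset (Fin n))).biUnion fun W =>
        Finset.univ.filter fun ω => (∀ γ ∈ (∅ : Finset Γ), loc ω γ ∈ W) ∧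
          3 * lam * W.card + b ≤ (D.filter fun γ => loc ω γ ∈ W).card := by
    intro ω hω
    have hb := (Finset.mem_filter.1 hω).2
    rw [Finset.mem_biUnion]
    refine ⟨Finset.univ.filter fun w => 3 * lam ≤ binLoad loc D ω w, Finset.mem_univ _, ?_⟩
    rw [Finset.mem_filter, card_filter_mem_eq_sum_binLoad]
    refine ⟨Finset.mem_univ _, by simp, ?_⟩
    set W := Finset.univ.filter fun w => 3 * lam ≤ binLoad loc D ω w with hW
    have h1 : ∑ w, (binLoad loc D ω w - 3 * lam) = ∑ w ∈ W, (binLoad loc D ω w - 3 * lam) := by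
      symm
      refine Finset.sum_subset (Finset.subset_univ _) fun w _ hw => ?_
      simp only [hW, Finset.mem_filter, Finset.mem_univ, true_and, not_le] at hw
      omega
    have h2 : ∑ w ∈ W, binLoad loc D ω w
        = ∑ w ∈ W, (binLoad loc D ω w - 3 * lam) + ∑ w ∈ W, 3 * lam := by
      rw [← Finset.sum_add_distrib]
      refine Finset.sum_congr rfl fun w hw => ?_
      have := (Finset.mem_filter.1 hw).2
      omega
    rw [h2, ← h1, Finset.sum_const, smul_eq_mul]
    linarith [mul_comm W.card (3 * lam)]
  calc ((Finset.univ.filter fun ω => b ≤ ∑ w, (binLoad loc D ω w - 3 * lam)).card : ℝ)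
      ≤ ∑ W : Finset (Fin n), ((Finset.univ.filter fun ω =>
          (∀ γ ∈ (∅ : Finset Γ), loc ω γ ∈ W) ∧
          3 * lam * W.card + b ≤ (D.filter fun γ => loc ω γ ∈ W).card).card : ℝ) := by
        exact_mod_cast (Finset.card_le_card hsub).trans Finset.card_biUnion_le
    _ ≤ ∑ W : Finset (Fin n),
          Fintype.card Ω * ((3 : ℝ) ^ b)⁻¹ * ((exp 2 / 27) ^ lam) ^ W.card := by
        refine Finset.sum_le_sum fun W _ => ?_
        refine (h.card_tail_le (Finset.empty_subset D) hD _).trans_eq ?_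
        rw [← exp_two_mul_div_pow, pow_add, Finset.card_empty, pow_zero]
        field_simp
    _ = _ := by
        rw [← Finset.mul_sum]
        have : (1 + (exp 2 / 27) ^ lam) ^ n
            = ∑ W : Finset (Fin n), ((exp 2 / 27) ^ lam) ^ W.card := by
          have := Finset.prod_one_add (s := (Finset.univ : Finset (Fin n)))
            (f := fun _ => (exp 2 / 27) ^ lam)
          simpa using this
        rw [this]
        field_simp

theorem NegCorrelated.card_exists_overfull_le (h : NegCorrelated loc) {lam : ℕ}
    (hD : D.card ≤ lam * n) :
    ((Finset.univ.filter fun ω => ∃ w, 3 * lam < binLoad loc D ω w).card : ℝ)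
      ≤ Fintype.card Ω * (n * (exp 2 / 27) ^ lam) := by
  classical
  have hsub : (Finset.univ.filter fun ω => ∃ w, 3 * lam < binLoad loc D ω w) ⊆
      (Finset.univ : Finset (Fin n)).biUnion fun w =>
        Finset.univ.filter fun ω => (∀ γ ∈ (∅ : Finset Γ), loc ω γ ∈ ({w} : Finset (Fin n))) ∧
          3 * lam * 1 ≤ (D.filter fun γ => loc ω γ ∈ ({w} : Finset (Fin n))).card := by
    intro ω hω
    obtain ⟨w, hw⟩ := (Finset.mem_filter.1 hω).2
    rw [Finset.mem_biUnion]
    refine ⟨w, Finset.mem_univ _, ?_⟩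
    rw [Finset.mem_filter, card_filter_mem_eq_sum_binLoad, Finset.sum_singleton]
    exact ⟨Finset.mem_univ _, by simp, by omega⟩
  calc ((Finset.univ.filter fun ω => ∃ w, 3 * lam < binLoad loc D ω w).card : ℝ)
      ≤ ∑ w : Fin n, ((Finset.univ.filter fun ω =>
          (∀ γ ∈ (∅ : Finset Γ), loc ω γ ∈ ({w} : Finset (Fin n))) ∧
          3 * lam * 1 ≤ (D.filter fun γ => loc ω γ ∈ ({w} : Finset (Fin n))).card).card : ℝ) := by
        exact_mod_cast (Finset.card_le_card hsub).trans Finset.card_biUnion_le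
    _ ≤ ∑ w : Fin n, Fintype.card Ω * (exp 2 / 27) ^ lam := by
        refine Finset.sum_le_sum fun w _ => ?_
        refine (h.card_tail_le (Finset.empty_subset D) hD _).trans_eq ?_
        have := exp_two_mul_div_pow lam 1
        rw [pow_one, Nat.cast_one] at this
        rw [← this, Finset.card_empty, pow_zero, Finset.card_singleton, Nat.cast_one]
        ring
    _ = _ := by
        rw [Finset.sum_const, Finset.card_univ, Fintype.card_fin, nsmul_eq_mul]
        ring

/-- The bound is `27 * (3/4)`, which makes the ratio `exp 3 / 27` below at most `3/4`. -/
theorem exp_three_le : exp 3 ≤ 81 / 4 := by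
  have h : exp 3 = exp 1 ^ 3 := by rw [← exp_nat_mul]; norm_num
  rw [h]
  calc exp 1 ^ 3 ≤ (2.7182818286 : ℝ) ^ 3 := by gcongr; exact exp_one_lt_d9.le
    _ ≤ 81 / 4 := by norm_num

theorem choose_le_exp_mul_div_pow (n w : ℕ) : (n.choose w : ℝ) ≤ (exp 1 * n / w) ^ w := by
  rcases Nat.eq_zero_or_pos w with hw | hw
  · simp [hw]
  have hw' : (0 : ℝ) < w := by exact_mod_cast hw
  have h1 : (n.choose w : ℝ) ≤ n ^ w / w.factorial := Nat.choose_le_pow_div w n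
  have h2 : (w : ℝ) ^ w / w.factorial ≤ exp w := pow_div_factorial_le_exp _ hw'.le w
  have h3 : exp (w : ℝ) = exp 1 ^ w := by rw [← exp_nat_mul, mul_one]
  calc (n.choose w : ℝ) ≤ n ^ w / w.factorial := h1
    _ = (n / w : ℝ) ^ w * ((w : ℝ) ^ w / w.factorial) := by
        rw [div_pow]; field_simp
    _ ≤ (n / w : ℝ) ^ w * exp 1 ^ w := by rw [← h3]; gcongr
    _ = _ := by rw [← mul_pow]; congr 1; ring

/-- The set `W` of bins hit by `T` has some size `w ≤ |T|` and holds at least `4 * w` items. The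
union bound over `W` costs `n.choose w`, which is paid for by `w` of the factors `3 * w / n` that
stem from `T` lying in `W`. -/
theorem NegCorrelated.card_forall_overfull_le (h : NegCorrelated loc) (hD : D.card ≤ n)
    (hT : T ⊆ D) (hq : 4 * T.card ≤ n) (hT0 : T.Nonempty) :
    ((Finset.univ.filter fun ω => ∀ γ ∈ T, 3 < binLoad loc D ω (loc ω γ)).card : ℝ)
      ≤ Fintype.card Ω * (T.card * (3 / 4) ^ T.card) := by
  obtain ⟨q, hqdef⟩ : ∃ q, q = T.card := ⟨_, rfl⟩
  rw [← hqdef] at hq ⊢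
  have hn : 0 < n := by have := hT0.card_pos; omega
  have hn' : (0 : ℝ) < n := by exact_mod_cast hn
  classical
  have hsub : (Finset.univ.filter fun ω => ∀ γ ∈ T, 3 < binLoad loc D ω (loc ω γ)) ⊆
      (Finset.Icc 1 q).biUnion fun w =>
        ((Finset.univ : Finset (Fin n)).powersetCard w).biUnion fun W =>
        Finset.univ.filter fun ω => (∀ γ ∈ T, loc ω γ ∈ W) ∧
          4 * w ≤ (D.filter fun γ => loc ω γ ∈ W).card := by
    intro ω hω
    have hb := (Finset.mem_filter.1 hω).2
    rw [Finset.mem_biUnion]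
    refine ⟨(T.image (loc ω)).card, Finset.mem_Icc.2
      ⟨(hT0.image _).card_pos, hqdef ▸ Finset.card_image_le⟩, ?_⟩
    rw [Finset.mem_biUnion]
    refine ⟨T.image (loc ω), Finset.mem_powersetCard.2 ⟨Finset.subset_univ _, rfl⟩, ?_⟩
    rw [Finset.mem_filter, card_filter_mem_eq_sum_binLoad]
    refine ⟨Finset.mem_univ _, fun γ hγ => Finset.mem_image_of_mem _ hγ, ?_⟩
    rw [mul_comm, ← smul_eq_mul, ← Finset.sum_const]
    refine Finset.sum_le_sum fun w hw => ?_
    obtain ⟨γ, hγ, rfl⟩ := Finset.mem_image.1 hw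
    exact hb γ hγ
  have hterm : ∀ w ∈ Finset.Icc 1 q, (n.choose w : ℝ) *
      ((3 * w / n) ^ q * exp (2 * w) / 3 ^ (4 * w)) ≤ (3 / 4) ^ q := by
    intro w hw
    obtain ⟨hw1, hwq⟩ := Finset.mem_Icc.1 hw
    have hw' : (0 : ℝ) < w := by exact_mod_cast hw1
    have h4 : (4 : ℝ) * w ≤ n := by exact_mod_cast (Nat.mul_le_mul_left 4 hwq).trans hq
    -- Of the `q` factors `3 * w / n`, `w` cancel against `(exp 1 * n / w) ^ w` and leave `(exp 3 /
    -- 27) ^ w`; the other `d` are at most `3/4` each because `4 * q ≤ n`.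
    obtain ⟨d, rfl⟩ : ∃ d, q = d + w := ⟨q - w, by omega⟩
    calc (n.choose w : ℝ) * ((3 * w / n) ^ (d + w) * exp (2 * w) / 3 ^ (4 * w))
        ≤ (exp 1 * n / w) ^ w * ((3 * w / n) ^ (d + w) * exp (2 * w) / 3 ^ (4 * w)) := by
          gcongr
          exact choose_le_exp_mul_div_pow n w
      _ = (3 * w / n) ^ d * (exp 3 / 27) ^ w := by
          have e1 : exp (2 * (w : ℝ)) = (exp 1 ^ 2) ^ w := by
            rw [← exp_nat_mul, ← exp_nat_mul]; congr 1; push_cast; ring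
          have e3 : exp 3 = exp 1 * exp 1 ^ 2 := by
            rw [← pow_succ', ← exp_nat_mul]; norm_num
          rw [e1, e3, pow_mul 3 4 w, pow_add]
          have : (exp 1 * exp 1 ^ 2 / 27 : ℝ) = (exp 1 * n / w) * (3 * w / n) * exp 1 ^ 2 / 3 ^ 4 := by
            field_simp
            norm_num
          rw [this, div_pow _ ((3 : ℝ) ^ 4), mul_pow (exp 1 * n / w * (3 * w / n)),
            mul_pow (exp 1 * n / w)]
          ring
      _ ≤ (3 / 4) ^ d * (3 / 4) ^ w := by
          have h1 : (3 * w / n : ℝ) ≤ 3 / 4 := by rw [div_le_iff₀ hn']; linarith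
          have h2 : exp 3 / 27 ≤ 3 / 4 := by have := exp_three_le; linarith
          exact mul_le_mul (pow_le_pow_left₀ (by positivity) h1 _)
            (pow_le_pow_left₀ (by positivity) h2 _) (by positivity) (by positivity)
      _ = _ := by rw [pow_add]
  calc ((Finset.univ.filter fun ω => ∀ γ ∈ T, 3 < binLoad loc D ω (loc ω γ)).card : ℝ)
      ≤ ∑ w ∈ Finset.Icc 1 q, ∑ W ∈ (Finset.univ : Finset (Fin n)).powersetCard w,
        ((Finset.univ.filter fun ω => (∀ γ ∈ T, loc ω γ ∈ W) ∧
          4 * w ≤ (D.filter fun γ => loc ω γ ∈ W).card).card : ℝ) := by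
        have := (Finset.card_le_card hsub).trans Finset.card_biUnion_le
        have h2 := this.trans (Finset.sum_le_sum fun w _ => Finset.card_biUnion_le)
        exact_mod_cast h2
    _ ≤ ∑ w ∈ Finset.Icc 1 q, ∑ W ∈ (Finset.univ : Finset (Fin n)).powersetCard w,
          (Fintype.card Ω * ((3 * w / n) ^ q * exp (2 * w) / 3 ^ (4 * w)) : ℝ) := by
        refine Finset.sum_le_sum fun w _ => Finset.sum_le_sum fun W hW => ?_
        have := h.card_tail_le (W := W) hT (lam := 1) (by simpa using hD) (4 * w)
        rw [(Finset.mem_powersetCard.1 hW).2, ← hqdef] at this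
        refine this.trans_eq ?_
        rw [Nat.cast_one, mul_one]
        ring
    _ = ∑ w ∈ Finset.Icc 1 q, (Fintype.card Ω : ℝ) * ((n.choose w : ℝ) *
          ((3 * w / n) ^ q * exp (2 * w) / 3 ^ (4 * w))) := by
        refine Finset.sum_congr rfl fun w _ => ?_
        rw [Finset.sum_const, Finset.card_powersetCard, Finset.card_univ, Fintype.card_fin,
          nsmul_eq_mul]
        ring
    _ ≤ ∑ w ∈ Finset.Icc 1 q, (Fintype.card Ω : ℝ) * (3 / 4) ^ q := by
        refine Finset.sum_le_sum fun w hw => ?_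
        gcongr
        exact hterm w hw
    _ = _ := by
        rw [Finset.sum_const, Nat.card_Icc, nsmul_eq_mul]
        simp only [Nat.add_sub_cancel]
        ring

end Occupancy

/-! ### One phase of the algorithm -/

namespace Ag

variable {n : ℕ} {I : IDT n} {H : Holding I}

/-- All copies that are created in Step 5. -/
abbrev ScatterCopy (H : Holding I) : Type := Σ u : Fin n, CopiesOf H u

/-- The node that receives a copy in Step 5. -/
def scatterLoc (F : Scatter H) (γ : ScatterCopy H) : Fin n := (F γ.1).1 γ.2

/-- A copy as a pair of a message and the number of the copy. -/
def copyPair (γ : ScatterCopy H) : I.Msg × ℕ := (γ.2.1.1, γ.2.2)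

theorem copyPair_injective : Function.Injective (copyPair (H := H)) := by
  rintro ⟨u, ⟨m, hm⟩, j⟩ ⟨u', ⟨m', hm'⟩, j'⟩ h
  simp only [copyPair, Prod.mk.injEq] at h
  obtain ⟨rfl, h2⟩ := h
  have : u = u' := Option.some.inj (hm.symm.trans hm')
  subst this
  have : j = j' := Fin.ext h2
  subst this
  rfl

/-- The nodes choose independently, so the bound for balanced assignments is multiplied over the
nodes, with `S` split according to the node that creates the copy. -/
theorem negCorrelated_scatterLoc [NeZero n] (H : Holding I) :
    NegCorrelated (scatterLoc (H := H)) := by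
  classical
  intro S W
  have hn : (0 : ℝ) < n := by exact_mod_cast Nat.pos_of_ne_zero (NeZero.ne n)
  let S' : (u : Fin n) → Finset (CopiesOf H u) := fun u =>
    Finset.univ.filter fun c => (⟨u, c⟩ : ScatterCopy H) ∈ S
  have hS : S.card = ∑ u, (S' u).card := by
    rw [← Finset.card_sigma]
    congr 1
    ext ⟨u, c⟩
    simp [S']
  have h2 : (Fintype.card (Scatter H) : ℝ)
      = ∏ u, (Fintype.card {f : CopiesOf H u → Fin n // EvenlySpread f} : ℝ) := by
    rw [← Nat.cast_prod, ← Fintype.card_pi]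
  have h3 : ∀ u, ((Finset.univ.filter fun
      f : {f : CopiesOf H u → Fin n // EvenlySpread f} => ∀ c ∈ S' u, f.1 c ∈ W).card : ℝ)
      ≤ Fintype.card {f : CopiesOf H u → Fin n // EvenlySpread f} *
        ((W.card : ℝ) / n) ^ (S' u).card := by
    intro u
    have e1 : (Finset.univ.filter fun
        f : {f : CopiesOf H u → Fin n // EvenlySpread f} => ∀ c ∈ S' u, f.1 c ∈ W).card
        = (Finset.univ.filter fun f : CopiesOf H u → Fin n =>
          EvenlySpread f ∧ ∀ c ∈ S' u, f c ∈ W).card := by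
      rw [← Finset.card_map (Function.Embedding.subtype _)]
      congr 1
      ext f
      simp only [Finset.mem_map, Finset.mem_filter, Finset.mem_univ, true_and,
        Function.Embedding.subtype_apply, Subtype.exists, exists_and_right, exists_eq_right]
      exact ⟨fun ⟨a, b⟩ => ⟨a, b⟩, fun ⟨a, b⟩ => ⟨a, b⟩⟩
    have e2 : Fintype.card {f : CopiesOf H u → Fin n // EvenlySpread f}
        = (Finset.univ.filter fun f : CopiesOf H u → Fin n => EvenlySpread f).card :=
      Fintype.card_subtype _
    have := card_evenlySpread_mapsTo_mul_le (n := n) (S' u) W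
    rw [e1, e2, div_pow, mul_div_assoc', le_div_iff₀ (by positivity)]
    exact_mod_cast this
  have h4 : (∏ u, ((Finset.univ.filter fun
      f : {f : CopiesOf H u → Fin n // EvenlySpread f} => ∀ c ∈ S' u, f.1 c ∈ W).card : ℝ))
      ≤ Fintype.card (Scatter H) * ((W.card : ℝ) / n) ^ S.card := by
    rw [h2, hS, ← Finset.prod_pow_eq_pow_sum, ← Finset.prod_mul_distrib]
    exact Finset.prod_le_prod (fun u _ => Nat.cast_nonneg _) fun u _ => h3 u
  refine le_trans (le_of_eq ?_) h4
  rw [← Nat.cast_prod, ← Fintype.card_piFinset]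
  congr 2
  ext F
  refine (@Finset.mem_filter _ _ (_) _ _).trans ?_
  rw [Fintype.mem_piFinset]
  constructor
  · rintro ⟨-, h⟩ u
    rw [Finset.mem_filter]
    refine ⟨Finset.mem_univ _, fun c hc => h ⟨u, c⟩ ?_⟩
    exact (Finset.mem_filter.1 hc).2
  · intro h
    refine ⟨Finset.mem_univ _, fun γ hγ => ?_⟩
    exact (Finset.mem_filter.1 (h γ.1)).2 γ.2 (Finset.mem_filter.2 ⟨Finset.mem_univ _, hγ⟩)

/-! ### Counting remaining messages and their copies. -/

open Classical in
/-- The remaining messages with destination `v`. -/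
noncomputable def remainingFor (H : Holding I) (v : Fin n) : Finset I.Msg :=
  Finset.univ.filter fun m => H m ≠ none ∧ I.target m = v

theorem mem_remainingFor {v : Fin n} {m : I.Msg} :
    m ∈ remainingFor H v ↔ H m ≠ none ∧ I.target m = v := by
  simp [remainingFor]

theorem remaining_eq (H : Holding I) :
    remaining H = Finset.univ.sup fun v => (remainingFor H v).card := rfl

theorem card_remainingFor_le (H : Holding I) (v : Fin n) :
    (remainingFor H v).card ≤ remaining H :=
  Finset.le_sup (f := fun v => (remainingFor H v).card) (Finset.mem_univ v)

theorem remaining_le_iff {b : ℕ} : remaining H ≤ b ↔ ∀ v, (remainingFor H v).card ≤ b := by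
  rw [remaining_eq, Finset.sup_le_iff]; simp

theorem remaining_eq_zero_iff : remaining H = 0 ↔ ∀ m, H m = none := by
  rw [← Nat.le_zero, remaining_le_iff]
  constructor
  · intro h m
    by_contra hm
    have := Finset.card_eq_zero.1 (Nat.le_zero.1 (h (I.target m)))
    have h' : m ∈ remainingFor H (I.target m) := mem_remainingFor.2 ⟨hm, rfl⟩
    simp [this] at h'
  · intro h v
    rw [Nat.le_zero, Finset.card_eq_zero, Finset.eq_empty_iff_forall_notMem]
    exact fun m hm => (mem_remainingFor.1 hm).1 (h m)

theorem remaining_le_of_imp {H' : Holding I} (h : ∀ m, H' m ≠ none → H m ≠ none) :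
    remaining H' ≤ remaining H :=
  remaining_le_iff.2 fun v => (Finset.card_le_card fun m hm => by
    rw [mem_remainingFor] at hm ⊢; exact ⟨h m hm.1, hm.2⟩).trans (card_remainingFor_le H v)

theorem exists_lt_card_remainingFor {b : ℕ} (h : b < remaining H) :
    ∃ v, b < (remainingFor H v).card := by
  by_contra! hc
  exact absurd (remaining_le_iff.2 hc) (not_le.2 h)

theorem numCopies_pos (H : Holding I) : 0 < numCopies H := by
  unfold numCopies; omega

theorem le_numCopies {κ : ℕ} (h0 : 0 < remaining H) (h : remaining H * κ ≤ n) :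
    κ ≤ numCopies H :=
  ((Nat.le_div_iff_mul_le h0).2 (by linarith [mul_comm κ (remaining H)])).trans (le_max_left _ _)

theorem le_ceilDiv_mul [NeZero n] (M : ℕ) : M ≤ (M ⌈/⌉ n) * n := by
  have := le_smul_ceilDiv (a := n) (b := M) (Nat.pos_of_ne_zero (NeZero.ne n))
  rwa [smul_eq_mul, mul_comm] at this

theorem ceilDiv_pos [NeZero n] {M : ℕ} (h : 0 < M) : 0 < M ⌈/⌉ n := by
  have := le_ceilDiv_mul (n := n) M
  by_contra h0
  have : M ⌈/⌉ n = 0 := by omega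
  simp [this] at *
  omega

theorem ceilDiv_le_one [NeZero n] {M : ℕ} (h : M ≤ n) : M ⌈/⌉ n ≤ 1 :=
  (ceilDiv_le_iff_le_mul (Nat.pos_of_ne_zero (NeZero.ne n))).2 (by simpa using h)

theorem ceilDiv_le_div_add_one [NeZero n] (M : ℕ) : M ⌈/⌉ n ≤ M / n + 1 := by
  have hn := Nat.pos_of_ne_zero (NeZero.ne n)
  rw [ceilDiv_le_iff_le_mul hn]
  have h1 := Nat.div_add_mod M n
  have h2 := Nat.mod_lt M hn
  rw [mul_add, mul_one]
  omega

/-- Shows that relays receive at most `⌈M/n⌉` copies per destination on average, both when messages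
are multiplied (`M ≤ n`) and when `k = 1`. -/
theorem numCopies_mul_remaining_le [NeZero n] (H : Holding I) :
    numCopies H * remaining H ≤ (remaining H ⌈/⌉ n) * n := by
  have h := le_ceilDiv_mul (n := n) (remaining H)
  rcases Nat.eq_zero_or_pos (remaining H) with h0 | h0
  · simp [h0]
  unfold numCopies
  rcases le_total (n / remaining H) 1 with h1 | h1
  · rw [max_eq_right h1]; omega
  · rw [max_eq_left h1]
    exact (Nat.div_mul_le_self _ _).trans (Nat.le_mul_of_pos_left _ (ceilDiv_pos h0))

open Classical in
/-- The copies of messages with destination `v`. -/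
noncomputable def copiesFor (H : Holding I) (v : Fin n) : Finset (ScatterCopy H) :=
  Finset.univ.filter fun γ => I.target γ.2.1.1 = v

theorem mem_copiesFor {v : Fin n} {γ : ScatterCopy H} :
    γ ∈ copiesFor H v ↔ I.target γ.2.1.1 = v := by simp [copiesFor]

theorem card_copiesFor (H : Holding I) (v : Fin n) :
    (copiesFor H v).card = numCopies H * (remainingFor H v).card := by
  classical
  have hcard : (remainingFor H v ×ˢ Finset.range (numCopies H)).card
      = numCopies H * (remainingFor H v).card := by
    rw [Finset.card_product, Finset.card_range, mul_comm]
  rw [← Finset.card_image_of_injective _ copyPair_injective, ← hcard]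
  congr 1
  ext ⟨m, j⟩
  simp only [Finset.mem_image, mem_copiesFor, Finset.mem_product, mem_remainingFor,
    Finset.mem_range]
  constructor
  · rintro ⟨⟨u, ⟨m', hm'⟩, j'⟩, ht, h⟩
    simp only [copyPair, Prod.mk.injEq] at h
    obtain ⟨rfl, rfl⟩ := h
    exact ⟨⟨by simp [hm'], ht⟩, j'.2⟩
  · rintro ⟨⟨hm, ht⟩, hj⟩
    obtain ⟨u, hu⟩ := Option.ne_none_iff_exists'.1 hm
    exact ⟨⟨u, ⟨m, hu⟩, ⟨j, hj⟩⟩, ht, rfl⟩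

theorem card_copiesFor_le [NeZero n] (H : Holding I) (v : Fin n) :
    (copiesFor H v).card ≤ (remaining H ⌈/⌉ n) * n := by
  rw [card_copiesFor]
  exact (Nat.mul_le_mul_left _ (card_remainingFor_le H v)).trans (numCopies_mul_remaining_le H)

theorem mem_arrivals {F : Scatter H} {w : Fin n} {c : I.Msg × ℕ} :
    c ∈ arrivals H F w ↔ ∃ γ, scatterLoc F γ = w ∧ copyPair γ = c := by
  unfold arrivals
  simp only [Finset.mem_filter, Finset.mem_product, Finset.mem_univ, true_and, Finset.mem_range]
  constructor
  · rintro ⟨-, u, hu, hj, h⟩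
    exact ⟨⟨u, ⟨c.1, hu⟩, ⟨c.2, hj⟩⟩, h, rfl⟩
  · rintro ⟨⟨u, ⟨m, hm⟩, j⟩, h, rfl⟩
    exact ⟨j.2, u, hm, j.2, h⟩

theorem filter_arrivals_eq_image [DecidableEq (Fin n)] (F : Scatter H) (w v : Fin n) :
    ((arrivals H F w).filter fun c => I.target c.1 = v)
      = ((copiesFor H v).filter fun γ => scatterLoc F γ = w).map ⟨copyPair, copyPair_injective⟩ := by
  ext c
  simp only [Finset.mem_filter, mem_arrivals, Finset.mem_map, Function.Embedding.coeFn_mk,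
    mem_copiesFor]
  constructor
  · rintro ⟨⟨γ, h1, rfl⟩, h2⟩; exact ⟨γ, ⟨h2, h1⟩, rfl⟩
  · rintro ⟨γ, ⟨h2, h1⟩, rfl⟩; exact ⟨⟨γ, h1, rfl⟩, h2⟩

theorem card_filter_arrivals (F : Scatter H) (w v : Fin n) :
    ((arrivals H F w).filter fun c => I.target c.1 = v).card
      = binLoad scatterLoc (copiesFor H v) F w := by
  rw [filter_arrivals_eq_image, Finset.card_map]
  rfl

theorem forwarded_subset (rule : ForwardRule I) (h : History I) (F : Scatter H) (w v : Fin n) :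
    forwarded rule h H F w v ⊆ (arrivals H F w).filter fun c => I.target c.1 = v :=
  rule.choose_subset _ _ _ _ _

theorem card_forwarded (rule : ForwardRule I) (h : History I) (F : Scatter H) (w v : Fin n) :
    (forwarded rule h H F w v).card = min (binLoad scatterLoc (copiesFor H v) F w) (capacity H) := by
  rw [← card_filter_arrivals]
  exact rule.choose_card _ _ _ _ _

/-! ### Which messages survive Steps 5 to 7. -/

section FinishPhase

variable [NeZero n] {rule : ForwardRule I} {s : State I} {F : Scatter H}

theorem finishPhase_holding_ne_none {m : I.Msg} :
    (finishPhase rule s H F).holding m ≠ none ↔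
      (∀ w v j, (m, j) ∉ forwarded rule s.history H F w v) ∧ H m ≠ none := by
  unfold finishPhase
  simp only
  split_ifs with h
  · simp only [ne_eq, not_true_eq_false, false_iff, not_and]
    intro h'
    obtain ⟨w, v, j, hj⟩ := h
    exact absurd hj (h' w v j)
  · push Not at h
    exact ⟨fun h' => ⟨h, h'⟩, fun h' => h'.2⟩

theorem finishPhase_holding_eq_some {m : I.Msg} {u : Fin n}
    (h : (finishPhase rule s H F).holding m = some u) : H m = some u := by
  unfold finishPhase at h
  simp only at h
  split_ifs at h
  exact h

theorem remaining_finishPhase_le : remaining (finishPhase rule s H F).holding ≤ remaining H :=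
  remaining_le_of_imp fun _ hm => (finishPhase_holding_ne_none.1 hm).2

/-- A relay whose copies for a destination do not exceed the capacity must forward all of them, so
no copy of a surviving message can be there. -/
theorem capacity_lt_binLoad_of_finishPhase {γ : ScatterCopy H}
    (h : (finishPhase rule s H F).holding γ.2.1.1 ≠ none) :
    capacity H < binLoad scatterLoc (copiesFor H (I.target γ.2.1.1)) F (scatterLoc F γ) := by
  by_contra hc
  have h1 := card_forwarded rule s.history F (scatterLoc F γ) (I.target γ.2.1.1)
  rw [min_eq_left (not_lt.1 hc), ← card_filter_arrivals] at h1
  have h2 := Finset.eq_of_subset_of_card_le (forwarded_subset rule s.history F _ _) h1.ge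
  refine (finishPhase_holding_ne_none.1 h).1 (scatterLoc F γ) (I.target γ.2.1.1) γ.2.2 ?_
  rw [h2, Finset.mem_filter, mem_arrivals]
  exact ⟨⟨γ, rfl, rfl⟩, rfl⟩

/-- None of the copies of a surviving message is forwarded, and a relay withholds exactly its excess
over the capacity. -/
theorem numCopies_mul_card_remainingFor_le (v : Fin n) :
    numCopies H * (remainingFor (finishPhase rule s H F).holding v).card
      ≤ ∑ w, (binLoad scatterLoc (copiesFor H v) F w - capacity H) := by
  classical
  have hcard : ∀ w, (((arrivals H F w).filter fun c => I.target c.1 = v) \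
      forwarded rule s.history H F w v).card
        = binLoad scatterLoc (copiesFor H v) F w - capacity H := by
    intro w
    rw [Finset.card_sdiff_of_subset (forwarded_subset rule s.history F w v), card_forwarded,
      card_filter_arrivals]
    omega
  calc _ = (remainingFor (finishPhase rule s H F).holding v ×ˢ Finset.range (numCopies H)).card := by
        rw [Finset.card_product, Finset.card_range, mul_comm]
    _ ≤ ((Finset.univ : Finset (Fin n)).biUnion fun w =>
          ((arrivals H F w).filter fun c => I.target c.1 = v) \
            forwarded rule s.history H F w v).card := by
        refine Finset.card_le_card ?_
        rintro ⟨m, j⟩ hmj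
        obtain ⟨hm, hj⟩ := Finset.mem_product.1 hmj
        obtain ⟨hm, ht⟩ := mem_remainingFor.1 hm
        obtain ⟨hnf, hH⟩ := finishPhase_holding_ne_none.1 hm
        obtain ⟨u, hu⟩ := Option.ne_none_iff_exists'.1 hH
        let γ : ScatterCopy H := ⟨u, ⟨m, hu⟩, ⟨j, Finset.mem_range.1 hj⟩⟩
        rw [Finset.mem_biUnion]
        refine ⟨scatterLoc F γ, Finset.mem_univ _, Finset.mem_sdiff.2 ⟨?_, hnf _ _ _⟩⟩
        rw [Finset.mem_filter, mem_arrivals]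
        exact ⟨⟨γ, rfl, rfl⟩, ht⟩
    _ ≤ _ := Finset.card_biUnion_le.trans_eq (Finset.sum_congr rfl fun w _ => hcard w)

/-- Deterministic progress: for a destination with remaining messages, some relay gets a copy and
forwards at least one, since the capacity is positive. -/
theorem remaining_finishPhase_lt (h0 : 0 < remaining H) :
    remaining (finishPhase rule s H F).holding < remaining H := by
  by_contra hc
  have hge := not_lt.1 hc
  obtain ⟨v, hv⟩ := exists_lt_card_remainingFor
    (show remaining H - 1 < remaining (finishPhase rule s H F).holding by omega)
  have hsub : remainingFor (finishPhase rule s H F).holding v ⊆ remainingFor H v := fun m hm => by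
    rw [mem_remainingFor] at hm ⊢
    exact ⟨(finishPhase_holding_ne_none.1 hm.1).2, hm.2⟩
  have heq := Finset.eq_of_subset_of_card_le hsub (by
    have := card_remainingFor_le H v
    omega)
  obtain ⟨m, hm⟩ : (remainingFor H v).Nonempty := by
    rw [← heq, ← Finset.card_pos]; omega
  obtain ⟨hm, ht⟩ := mem_remainingFor.1 hm
  obtain ⟨u, hu⟩ := Option.ne_none_iff_exists'.1 hm
  let γ : ScatterCopy H := ⟨u, ⟨m, hu⟩, ⟨0, numCopies_pos H⟩⟩
  have hpos : 0 < (forwarded rule s.history H F (scatterLoc F γ) v).card := by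
    rw [card_forwarded]
    refine lt_min (Finset.card_pos.2 ⟨γ, Finset.mem_filter.2 ⟨mem_copiesFor.2 ht, rfl⟩⟩) ?_
    have := ceilDiv_pos (n := n) h0
    unfold capacity
    omega
  obtain ⟨⟨m', j⟩, hmj⟩ := Finset.card_pos.1 hpos
  obtain ⟨ha, ht'⟩ := Finset.mem_filter.1 (forwarded_subset _ _ _ _ _ hmj)
  obtain ⟨⟨u', ⟨m'', hm''⟩, j'⟩, -, hγ⟩ := mem_arrivals.1 ha
  simp only [copyPair, Prod.mk.injEq] at hγ
  obtain ⟨rfl, -⟩ := hγ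
  have hmem : m'' ∈ remainingFor H v := mem_remainingFor.2 ⟨by simp [hm''], ht'⟩
  rw [← heq, mem_remainingFor] at hmem
  exact (finishPhase_holding_ne_none.1 hmem.1).1 _ _ _ hmj

theorem received_finishPhase
    (hs : ∀ v m, m ∈ s.received v ↔ I.target m = v ∧ H m = none) (v : Fin n) (m : I.Msg) :
    m ∈ (finishPhase rule s H F).received v ↔
      I.target m = v ∧ (finishPhase rule s H F).holding m = none := by
  have hmem : ∀ {w v' j}, (m, j) ∈ forwarded rule s.history H F w v' →
      I.target m = v' ∧ H m ≠ none := by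
    intro w v' j hj
    obtain ⟨ha, ht⟩ := Finset.mem_filter.1 (forwarded_subset _ _ _ _ _ hj)
    obtain ⟨⟨u', ⟨m'', hm''⟩, j'⟩, -, hγ⟩ := mem_arrivals.1 ha
    simp only [copyPair, Prod.mk.injEq] at hγ
    obtain ⟨rfl, -⟩ := hγ
    exact ⟨ht, by simp [hm'']⟩
  have h1 : m ∈ (finishPhase rule s H F).received v ↔
      m ∈ s.received v ∨ ∃ w j, (m, j) ∈ forwarded rule s.history H F w v := by
    unfold finishPhase
    simp
  have h2 := (finishPhase_holding_ne_none (rule := rule) (s := s) (F := F) (m := m)).not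
  rw [not_not] at h2
  rw [h1, h2, hs]
  constructor
  · rintro (⟨h, h'⟩ | ⟨w, j, hj⟩)
    · exact ⟨h, fun hh => hh.2 h'⟩
    · exact ⟨(hmem hj).1, fun hh => hh.1 w v j hj⟩
  · rintro ⟨h, h'⟩
    by_cases hH : H m = none
    · exact Or.inl ⟨h, hH⟩
    · have : ¬ ∀ w v j, (m, j) ∉ forwarded rule s.history H F w v := fun hh => h' ⟨hh, hH⟩
      push Not at this
      obtain ⟨w, v', j, hj⟩ := this
      have := (hmem hj).1
      exact Or.inr ⟨w, j, by rw [← h, this]; exact hj⟩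

end FinishPhase

end Ag

/-! ### The number of rounds of a phase -/

/-- Positions in one residue class are determined by the quotient of their offset from `P` by `n`,
which is at most `(h - 1) / n`. -/
theorem card_le_of_modEq_of_mem_Ico {β : Type} {X : Finset β} {pos : β → ℕ}
    (hinj : Set.InjOn pos X) {n w P h : ℕ} (hX : ∀ m ∈ X, P ≤ pos m ∧ pos m < P + h)
    (hmod : ∀ m ∈ X, pos m % n = w) : X.card ≤ (h - 1) / n + 1 := by
  rw [← Finset.card_range ((h - 1) / n + 1)]
  refine Finset.card_le_card_of_injOn (fun m => (pos m - P) / n) ?_ ?_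
  · intro m hm
    have := hX m hm
    rw [Finset.mem_coe, Finset.mem_range]
    exact Nat.lt_succ_of_le (Nat.div_le_div_right (by omega))
  · intro a ha b hb hab
    apply hinj ha hb
    have ha' := hX a ha
    have hb' := hX b hb
    have h1 : pos a - P + P ≡ pos b - P + P [MOD n] := by
      rw [Nat.sub_add_cancel ha'.1, Nat.sub_add_cancel hb'.1]
      exact (hmod a ha).trans (hmod b hb).symm
    have h2 : (pos a - P) % n = (pos b - P) % n := Nat.ModEq.add_right_cancel' P h1
    have h3 := Nat.div_add_mod (pos a - P) n
    have h4 := Nat.div_add_mod (pos b - P) n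
    simp only at hab
    rw [hab, h2] at h3
    omega

theorem EvenlySpread.card_le_of_card_le {α : Type} [Fintype α] {n : ℕ} {f : α → Fin n}
    (hf : EvenlySpread f) {lam : ℕ} (h : Fintype.card α ≤ lam * n) (w : Fin n) :
    (Finset.univ.filter fun a => f a = w).card ≤ lam := by
  by_contra! hc
  have h1 : Fintype.card α = ∑ w, (Finset.univ.filter fun a => f a = w).card :=
    Finset.card_eq_sum_card_fiberwise (fun _ _ => by simp)
  have h2 : ∑ _w : Fin n, lam < ∑ w, (Finset.univ.filter fun a => f a = w).card := by
    refine Finset.sum_lt_sum (fun w' _ => ?_) ⟨w, Finset.mem_univ _, hc⟩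
    have := hf w w'
    omega
  rw [Finset.sum_const, Finset.card_univ, Fintype.card_fin, smul_eq_mul, mul_comm] at h2
  omega

namespace Ag

variable {n : ℕ} {I : IDT n} {H : Holding I}

/-! ### The order of Step 2 and the positions of the messages. -/

theorem before_trans {a b c : I.Msg} (h : IDT.before a b) (h' : IDT.before b c) :
    IDT.before a c := by
  unfold IDT.before at *
  rcases h with h | ⟨h, h2⟩ <;> rcases h' with h' | ⟨h', h2'⟩
  · exact Or.inl (h.trans h')
  · exact Or.inl (h' ▸ h)
  · exact Or.inl (h ▸ h')
  · exact Or.inr ⟨h.trans h', h2.trans h2'⟩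

theorem not_before_self (a : I.Msg) : ¬ IDT.before a a := by
  simp [IDT.before]

theorem before_or_before {a b : I.Msg} (h : a ≠ b) : IDT.before a b ∨ IDT.before b a := by
  obtain ⟨u, i⟩ := a
  obtain ⟨v, j⟩ := b
  unfold IDT.before
  rcases lt_trichotomy u v with huv | huv | huv
  · exact Or.inl (Or.inl huv)
  · subst huv
    rcases lt_trichotomy (i : ℕ) (j : ℕ) with hij | hij | hij
    · exact Or.inl (Or.inr ⟨rfl, hij⟩)
    · exact absurd (by rw [Fin.ext hij]) h
    · exact Or.inr (Or.inr ⟨rfl, hij⟩)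
  · exact Or.inr (Or.inl huv)

/-- The message `a` precedes `b` in the order of Step 2. -/
def Precedes (H : Holding I) (a b : I.Msg) : Prop :=
  ∃ u u' : Fin n, H b = some u ∧ H a = some u' ∧ (u' < u ∨ (u' = u ∧ IDT.before a b))

theorem Precedes.trans {a b c : I.Msg} (h : Precedes H a b) (h' : Precedes H b c) :
    Precedes H a c := by
  obtain ⟨u, u', hu, hu', h⟩ := h
  obtain ⟨x, x', hx, hx', h'⟩ := h'
  obtain rfl : u = x' := Option.some.inj (hu.symm.trans hx')
  refine ⟨x, u', hx, hu', ?_⟩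
  rcases h with h | ⟨rfl, h2⟩ <;> rcases h' with h' | ⟨rfl, h2'⟩
  · exact Or.inl (h.trans h')
  · exact Or.inl h
  · exact Or.inl h'
  · exact Or.inr ⟨rfl, before_trans h2 h2'⟩

theorem not_precedes_self (a : I.Msg) : ¬ Precedes H a a := by
  rintro ⟨u, u', hu, hu', h⟩
  obtain rfl : u = u' := Option.some.inj (hu.symm.trans hu')
  rcases h with h | ⟨-, h⟩
  · exact lt_irrefl _ h
  · exact not_before_self a h

theorem precedes_or_precedes {a b : I.Msg} (ha : H a ≠ none) (hb : H b ≠ none) (h : a ≠ b) :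
    Precedes H a b ∨ Precedes H b a := by
  obtain ⟨u, hu⟩ := Option.ne_none_iff_exists'.1 ha
  obtain ⟨v, hv⟩ := Option.ne_none_iff_exists'.1 hb
  rcases lt_trichotomy u v with huv | rfl | huv
  · exact Or.inl ⟨v, u, hv, hu, Or.inl huv⟩
  · rcases before_or_before h with h | h
    · exact Or.inl ⟨u, u, hv, hu, Or.inr ⟨rfl, h⟩⟩
    · exact Or.inr ⟨u, u, hu, hv, Or.inr ⟨rfl, h⟩⟩
  · exact Or.inr ⟨u, v, hu, hv, Or.inl huv⟩

open Classical in
theorem position_eq (H : Holding I) (m : I.Msg) :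
    position H m = (Finset.univ.filter fun m' : I.Msg => Precedes H m' m).card := by
  unfold position Precedes
  congr

theorem position_lt_of_precedes {a b : I.Msg} (h : Precedes H a b) :
    position H a < position H b := by
  classical
  rw [position_eq, position_eq]
  refine Finset.card_lt_card (Finset.ssubset_iff_of_subset ?_ |>.2 ⟨a, ?_, ?_⟩)
  · intro x hx
    rw [Finset.mem_filter] at hx ⊢
    exact ⟨hx.1, hx.2.trans h⟩
  · exact Finset.mem_filter.2 ⟨Finset.mem_univ _, h⟩
  · exact fun ha => not_precedes_self a (Finset.mem_filter.1 ha).2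

theorem position_injOn (H : Holding I) : Set.InjOn (position H) {m | H m ≠ none} := by
  intro a ha b hb hab
  by_contra h
  rcases precedes_or_precedes ha hb h with h | h
  · exact absurd hab (position_lt_of_precedes h).ne
  · exact absurd hab (position_lt_of_precedes h).ne'

open Classical in
/-- The number of messages that node `u` holds. -/
noncomputable def heldCount (H : Holding I) (u : Fin n) : ℕ :=
  (Finset.univ.filter fun m => H m = some u).card

/-- The messages of one node occupy a contiguous block of positions, so Step 2 spreads them evenly
over the links of that node. -/
theorem position_mem_Ico {m : I.Msg} {u : Fin n} (hm : H m = some u) :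
    ∑ u' ∈ Finset.univ.filter (· < u), heldCount H u' ≤ position H m ∧
      position H m < ∑ u' ∈ Finset.univ.filter (· < u), heldCount H u' + heldCount H u := by
  classical
  have hsum : ∑ u' ∈ Finset.univ.filter (· < u), heldCount H u'
      = (Finset.univ.filter fun m' : I.Msg => ∃ u' < u, H m' = some u').card := by
    unfold heldCount
    rw [← Finset.card_biUnion]
    · congr 1
      ext m'
      simp
    · intro x _ y _ hxy
      rw [Function.onFun, Finset.disjoint_left]
      intro m' h1 h2
      exact hxy (Option.some.inj ((Finset.mem_filter.1 h1).2.symm.trans (Finset.mem_filter.1 h2).2))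
  rw [hsum, position_eq]
  constructor
  · refine Finset.card_le_card fun m' hm' => ?_
    obtain ⟨-, u', hu', h⟩ := Finset.mem_filter.1 hm'
    exact Finset.mem_filter.2 ⟨Finset.mem_univ _, u, u', hm, h, Or.inl hu'⟩
  · calc (Finset.univ.filter fun m' : I.Msg => Precedes H m' m).card
        < (insert m (Finset.univ.filter fun m' : I.Msg => Precedes H m' m)).card := by
          refine Finset.card_lt_card (Finset.ssubset_insert ?_)
          exact fun h => not_precedes_self m (Finset.mem_filter.1 h).2
      _ ≤ ((Finset.univ.filter fun m' : I.Msg => ∃ u' < u, H m' = some u') ∪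
            Finset.univ.filter fun m' => H m' = some u).card := by
          refine Finset.card_le_card fun m' hm' => ?_
          rw [Finset.mem_union, Finset.mem_filter, Finset.mem_filter]
          rcases Finset.mem_insert.1 hm' with rfl | hm'
          · exact Or.inr ⟨Finset.mem_univ _, hm⟩
          · obtain ⟨x, x', hx, hx', h⟩ := (Finset.mem_filter.1 hm').2
            obtain rfl : u = x := Option.some.inj (hm.symm.trans hx)
            rcases h with h | ⟨rfl, h⟩
            · exact Or.inl ⟨Finset.mem_univ _, x', h, hx'⟩
            · exact Or.inr ⟨Finset.mem_univ _, hx'⟩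
      _ ≤ _ := Finset.card_union_le _ _

theorem position_lt_mul_remaining {m : I.Msg} (hm : H m ≠ none) :
    position H m < n * remaining H := by
  classical
  rw [position_eq]
  calc (Finset.univ.filter fun m' : I.Msg => Precedes H m' m).card
      < (insert m (Finset.univ.filter fun m' : I.Msg => Precedes H m' m)).card := by
        refine Finset.card_lt_card (Finset.ssubset_insert ?_)
        exact fun h => not_precedes_self m (Finset.mem_filter.1 h).2
    _ ≤ ((Finset.univ : Finset (Fin n)).biUnion fun v => remainingFor H v).card := by
        refine Finset.card_le_card fun m' hm' => ?_
        rw [Finset.mem_biUnion]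
        refine ⟨I.target m', Finset.mem_univ _, mem_remainingFor.2 ⟨?_, rfl⟩⟩
        rcases Finset.mem_insert.1 hm' with rfl | hm'
        · exact hm
        · obtain ⟨x, x', hx, hx', h⟩ := (Finset.mem_filter.1 hm').2
          simp [hx']
    _ ≤ ∑ _v : Fin n, remaining H :=
        Finset.card_biUnion_le.trans (Finset.sum_le_sum fun v _ => card_remainingFor_le H v)
    _ = _ := by simp

/-! ### Bounds for the rounds of Steps 2 and 5, and the potential. -/

section Rounds

variable [NeZero n]

theorem redistribute_eq_none {m : I.Msg} : redistribute H m = none ↔ H m = none := by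
  simp [redistribute]

theorem redistribute_eq_some {m : I.Msg} {w : Fin n} :
    redistribute H m = some w ↔ H m ≠ none ∧ position H m % n = w := by
  unfold redistribute
  cases h : H m with
  | none => simp
  | some u => simp [Fin.ext_iff, Fin.ofNat]

theorem remaining_redistribute (H : Holding I) : remaining (redistribute H) = remaining H :=
  le_antisymm (remaining_le_of_imp fun _ h h' => h (redistribute_eq_none.2 h'))
    (remaining_le_of_imp fun _ h h' => h (redistribute_eq_none.1 h'))

/-- At most `n * M` messages remain in total, since each destination accounts for at most `M` of
them, and redistribution shares them equally. -/
theorem heldCount_redistribute_le (H : Holding I) (w : Fin n) :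
    heldCount (redistribute H) w ≤ remaining H := by
  classical
  have hn := Nat.pos_of_ne_zero (NeZero.ne n)
  by_cases h0 : remaining H = 0
  · unfold heldCount
    rw [h0, Nat.le_zero, Finset.card_eq_zero, Finset.filter_eq_empty_iff]
    intro m _ hm
    exact (redistribute_eq_some.1 hm).1 (remaining_eq_zero_iff.1 h0 m)
  refine (card_le_of_modEq_of_mem_Ico (pos := position H) (n := n) (w := w) (P := 0)
    (h := n * remaining H) ?_ ?_ ?_).trans ?_
  · refine (position_injOn H).mono fun m hm => ?_
    exact (redistribute_eq_some.1 (Finset.mem_filter.1 (Finset.mem_coe.1 hm)).2).1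
  · intro m hm
    refine ⟨Nat.zero_le _, ?_⟩
    rw [zero_add]
    exact position_lt_mul_remaining (redistribute_eq_some.1 (Finset.mem_filter.1 hm).2).1
  · intro m hm
    exact (redistribute_eq_some.1 (Finset.mem_filter.1 hm).2).2
  · rw [Nat.succ_le_iff, Nat.div_lt_iff_lt_mul hn, mul_comm]
    exact Nat.sub_lt (Nat.mul_pos (Nat.pos_of_ne_zero h0) hn) one_pos

theorem redistributeRounds_le {B : ℕ} (h : ∀ u, heldCount H u / n ≤ B) :
    redistributeRounds H ≤ B + 1 := by
  classical
  unfold redistributeRounds linkRounds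
  refine Finset.sup_le fun u _ => Finset.sup_le fun w _ => ?_
  refine (card_le_of_modEq_of_mem_Ico (pos := position H) (n := n) (w := w)
    (P := ∑ u' ∈ Finset.univ.filter (· < u), heldCount H u')
    (h := heldCount H u) ?_ ?_ ?_).trans ?_
  · refine (position_injOn H).mono fun m hm => ?_
    exact (redistribute_eq_some.1 (Finset.mem_filter.1 (Finset.mem_coe.1 hm)).2.2).1
  · intro m hm
    exact position_mem_Ico (Finset.mem_filter.1 hm).2.1
  · intro m hm
    exact (redistribute_eq_some.1 (Finset.mem_filter.1 hm).2.2).2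
  · exact Nat.succ_le_succ ((Nat.div_le_div_right (Nat.sub_le _ _)).trans (h u))

theorem scatterRounds_le (hH : ∀ u, heldCount H u ≤ remaining H) (F : Scatter H) :
    scatterRounds H F ≤ remaining H ⌈/⌉ n := by
  classical
  unfold scatterRounds linkRounds
  refine Finset.sup_le fun u _ => Finset.sup_le fun w _ => ?_
  refine (F u).2.card_le_of_card_le ?_ w
  rw [Fintype.card_prod, Fintype.card_fin, mul_comm]
  refine le_trans (Nat.mul_le_mul_left _ ?_) (numCopies_mul_remaining_le H)
  refine le_trans (le_of_eq ?_) (hH u)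
  rw [Fintype.card_subtype]
  unfold heldCount
  congr

theorem heldCount_finishPhase_le {rule : ForwardRule I} {s : State I} {F : Scatter H}
    (u : Fin n) : heldCount (finishPhase rule s H F).holding u ≤ heldCount H u := by
  classical
  unfold heldCount
  refine Finset.card_le_card fun m hm => ?_
  rw [Finset.mem_filter] at hm ⊢
  exact ⟨hm.1, finishPhase_holding_eq_some hm.2⟩

/-- If `ρ` bounds the rounds so far plus the rounds needed for redistribution, then so it does
after a phase, when it is increased by a constant and a multiple of `remaining / n`. -/
theorem rounds_finishPhase_le {rule : ForwardRule I} {s : State I}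
    (F : Scatter (redistribute s.holding)) {ρ : ℝ}
    (h : ∀ u, (s.rounds : ℝ) + (heldCount s.holding u : ℝ) / n ≤ ρ) (u : Fin n) :
    ((finishPhase rule s (redistribute s.holding) F).rounds : ℝ) +
      (heldCount (finishPhase rule s (redistribute s.holding) F).holding u : ℝ) / n
      ≤ ρ + 9 + 6 * ((remaining s.holding : ℝ) / n) := by
  have hn : (0 : ℝ) < n := by exact_mod_cast Nat.pos_of_ne_zero (NeZero.ne n)
  have h1 : (redistributeRounds s.holding : ℝ) ≤ ρ - s.rounds + 1 := by
    have h0 : ∀ u, heldCount s.holding u / n ≤ ⌊ρ - s.rounds⌋₊ := by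
      intro u
      refine Nat.le_floor ?_
      have h2 := h u
      have h3 : ((heldCount s.holding u / n : ℕ) : ℝ) ≤ (heldCount s.holding u : ℝ) / n :=
        Nat.cast_div_le
      linarith
    have h2 : ((redistributeRounds s.holding : ℕ) : ℝ) ≤ ((⌊ρ - s.rounds⌋₊ + 1 : ℕ) : ℝ) := by
      exact_mod_cast redistributeRounds_le h0
    have h3 : (⌊ρ - s.rounds⌋₊ : ℝ) ≤ ρ - s.rounds := by
      refine Nat.floor_le ?_
      have h4 := h u
      have : (0 : ℝ) ≤ (heldCount s.holding u : ℝ) / n := by positivity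
      linarith
    push_cast at h2
    linarith
  have hlam : ((remaining s.holding ⌈/⌉ n : ℕ) : ℝ) ≤ (remaining s.holding : ℝ) / n + 1 := by
    have h2 : ((remaining s.holding ⌈/⌉ n : ℕ) : ℝ) ≤ ((remaining s.holding / n + 1 : ℕ) : ℝ) := by
      exact_mod_cast ceilDiv_le_div_add_one (n := n) (remaining s.holding)
    have h3 : ((remaining s.holding / n : ℕ) : ℝ) ≤ (remaining s.holding : ℝ) / n :=
      Nat.cast_div_le
    push_cast at h2
    linarith
  have hsc : (scatterRounds (redistribute s.holding) F : ℝ)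
      ≤ ((remaining s.holding ⌈/⌉ n : ℕ) : ℝ) := by
    have := scatterRounds_le (H := redistribute s.holding)
      (fun u => by rw [remaining_redistribute]; exact heldCount_redistribute_le _ u) F
    rw [remaining_redistribute] at this
    exact_mod_cast this
  have hcap : (capacity (redistribute s.holding) : ℝ)
      = 3 * ((remaining s.holding ⌈/⌉ n : ℕ) : ℝ) := by
    unfold capacity
    rw [remaining_redistribute]
    push_cast
    ring
  have hheld : (heldCount (finishPhase rule s (redistribute s.holding) F).holding u : ℝ) / n
      ≤ (remaining s.holding : ℝ) / n := by
    gcongr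
    exact_mod_cast (heldCount_finishPhase_le u).trans (heldCount_redistribute_le _ u)
  have hr : ((finishPhase rule s (redistribute s.holding) F).rounds : ℝ)
      = s.rounds + 1 + redistributeRounds s.holding + 1 + 1
        + scatterRounds (redistribute s.holding) F + capacity (redistribute s.holding)
        + scatterRounds (redistribute s.holding) F := by
    unfold finishPhase
    push_cast
    rfl
  -- The `9` consists of Steps 1, 3 and 4, the `+ 1` of redistribution and five ceilings (scatter,
  -- three for forwarding, confirmations). The `6` consists of these five and the load that the next
  -- redistribution has to move.
  rw [hr, hcap]
  linarith

end Rounds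

end Ag

/-! ### The messages that are left after a phase -/

namespace Ag

open Real

variable {n : ℕ} {I : IDT n} {H : Holding I}

open Classical in
/-- The first `κ` copies of each message in `B`. -/
noncomputable def copiesOfSet (H : Holding I) (B : Finset I.Msg) (κ : ℕ) :
    Finset (ScatterCopy H) :=
  Finset.univ.filter fun γ => γ.2.1.1 ∈ B ∧ (γ.2.2 : ℕ) < κ

theorem card_copiesOfSet {B : Finset I.Msg} {κ : ℕ} (hB : ∀ m ∈ B, H m ≠ none)
    (hκ : κ ≤ numCopies H) : (copiesOfSet H B κ).card = κ * B.card := by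
  classical
  have hcard : (B ×ˢ Finset.range κ).card = κ * B.card := by
    rw [Finset.card_product, Finset.card_range, mul_comm]
  rw [← Finset.card_image_of_injective _ copyPair_injective, ← hcard]
  congr 1
  ext ⟨m, j⟩
  simp only [Finset.mem_image, copiesOfSet, Finset.mem_filter, Finset.mem_univ, true_and,
    Finset.mem_product, Finset.mem_range]
  constructor
  · rintro ⟨⟨u, ⟨m', hm'⟩, j'⟩, hc, h⟩
    simp only [copyPair, Prod.mk.injEq] at h
    obtain ⟨rfl, rfl⟩ := h
    exact hc
  · rintro ⟨hm, hj⟩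
    obtain ⟨u, hu⟩ := Option.ne_none_iff_exists'.1 (hB m hm)
    exact ⟨⟨u, ⟨m, hu⟩, ⟨j, hj.trans_le hκ⟩⟩, ⟨hm, hj⟩, rfl⟩

theorem natCast_card_exists_le {Ω : Type} [Fintype Ω] {p : Ω → Prop} [DecidablePred p]
    {q : Fin n → Ω → Prop} [∀ v, DecidablePred (q v)] (hpq : ∀ ω, p ω → ∃ v, q v ω) {x : ℝ}
    (hq : ∀ v, ((Finset.univ.filter (q v)).card : ℝ) ≤ Fintype.card Ω * x) :
    ((Finset.univ.filter p).card : ℝ) ≤ Fintype.card Ω * (n * x) := by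
  classical
  have hsub : Finset.univ.filter p ⊆ (Finset.univ : Finset (Fin n)).biUnion fun v =>
      Finset.univ.filter (q v) := by
    intro ω hω
    obtain ⟨v, hv⟩ := hpq ω (Finset.mem_filter.1 hω).2
    exact Finset.mem_biUnion.2 ⟨v, Finset.mem_univ _, Finset.mem_filter.2 ⟨Finset.mem_univ _, hv⟩⟩
  calc ((Finset.univ.filter p).card : ℝ)
      ≤ ∑ v : Fin n, ((Finset.univ.filter (q v)).card : ℝ) := by
        exact_mod_cast (Finset.card_le_card hsub).trans Finset.card_biUnion_le
    _ ≤ ∑ _v : Fin n, (Fintype.card Ω : ℝ) * x := Finset.sum_le_sum fun v _ => hq v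
    _ = _ := by
        rw [Finset.sum_const, Finset.card_univ, Fintype.card_fin, nsmul_eq_mul]
        ring

variable [NeZero n] {rule : ForwardRule I} {s : State I}

theorem exp_two_le : exp 2 / 27 ≤ 28 / 100 := by
  have h : exp 2 = exp 1 ^ 2 := by rw [← exp_nat_mul]; norm_num
  have h2 : exp 1 ^ 2 ≤ (2.7182818286 : ℝ) ^ 2 :=
    pow_le_pow_left₀ (exp_pos 1).le exp_one_lt_d9.le 2
  rw [h]
  norm_num at h2 ⊢
  linarith

open Classical in
-- The survivors for `v`, with at least `κ` copies each, are paid for by the total excess for `v`.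
-- If `3 * κ` times their number exceeds `n`, then that excess is more than `n / 3`.
theorem card_lt_three_mul_remaining_le (h0 : 0 < remaining H) {κ : ℕ} (hκ : κ ≤ numCopies H) :
    ((Finset.univ.filter fun F : Scatter H =>
        n < 3 * κ * remaining (finishPhase rule s H F).holding).card : ℝ)
      ≤ Fintype.card (Scatter H) * (n * (9 / 10) ^ n) := by
  set lam := remaining H ⌈/⌉ n with hlam
  have hlam0 : 0 < lam := ceilDiv_pos h0
  refine natCast_card_exists_le
    (q := fun v F => n / 3 + 1 ≤ ∑ w, (binLoad scatterLoc (copiesFor H v) F w - 3 * lam)) ?_ ?_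
  · intro F hF
    have hκ0 : 0 < κ := by
      rcases Nat.eq_zero_or_pos κ with h | h
      · simp [h] at hF
      · exact h
    have h1 : n / (3 * κ) < remaining (finishPhase rule s H F).holding := by
      rw [Nat.div_lt_iff_lt_mul (by positivity)]
      linarith [mul_comm (3 * κ) (remaining (finishPhase rule s H F).holding)]
    obtain ⟨v, hv⟩ := exists_lt_card_remainingFor h1
    refine ⟨v, ?_⟩
    rw [Nat.div_lt_iff_lt_mul (by positivity)] at hv
    have h2 := numCopies_mul_card_remainingFor_le (rule := rule) (s := s) (F := F) v
    have h3 := Nat.mul_le_mul_right (remainingFor (finishPhase rule s H F).holding v).card hκ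
    change _ ≤ ∑ w, (binLoad scatterLoc (copiesFor H v) F w - 3 * lam) at h2
    have h4 : (remainingFor (finishPhase rule s H F).holding v).card * (3 * κ)
        = 3 * (κ * (remainingFor (finishPhase rule s H F).holding v).card) := by ring
    omega
  · intro v
    refine le_trans (le_of_eq (by congr)) (((negCorrelated_scatterLoc H).card_excess_le
      (card_copiesFor_le H v) (n / 3 + 1)).trans ?_)
    gcongr
    have hx0 : 0 ≤ exp 2 / 27 := by positivity
    have hx : (exp 2 / 27) ^ lam ≤ 28 / 100 :=
      (pow_le_of_le_one hx0 (exp_two_le.trans (by norm_num)) hlam0.ne').trans exp_two_le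
    rw [div_le_iff₀ (by positivity)]
    have h3 : (1 + (exp 2 / 27) ^ lam) ^ n ≤ (128 / 100) ^ n :=
      pow_le_pow_left₀ (by positivity) (by linarith) n
    refine h3.trans ?_
    -- Cubing avoids the fractional exponent `n / 3`: what is needed is `1.28 ^ 3 ≤ 3 * 0.9 ^ 3`,
    -- and the `+ 1` in `n / 3 + 1` absorbs the floor.
    refine le_of_pow_le_pow_left₀ (n := 3) (by norm_num) (by positivity) ?_
    calc (((128 : ℝ) / 100) ^ n) ^ 3 = ((128 / 100) ^ 3) ^ n := by rw [← pow_mul, ← pow_mul, mul_comm]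
      _ ≤ ((9 / 10) ^ 3 * 3) ^ n := pow_le_pow_left₀ (by norm_num) (by norm_num) n
      _ = ((9 / 10) ^ n) ^ 3 * 3 ^ n := by rw [mul_pow, ← pow_mul, ← pow_mul, mul_comm 3 n]
      _ ≤ ((9 / 10) ^ n) ^ 3 * 3 ^ ((n / 3 + 1) * 3) := by
          gcongr
          · norm_num
          · omega
      _ = _ := by rw [mul_pow, pow_mul 3 _ 3]

open Classical in
theorem card_remaining_pos_le :
    ((Finset.univ.filter fun F : Scatter H =>
        0 < remaining (finishPhase rule s H F).holding).card : ℝ)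
      ≤ Fintype.card (Scatter H) * (n * (n * (28 / 100) ^ (remaining H ⌈/⌉ n))) := by
  set lam := remaining H ⌈/⌉ n with hlam
  refine natCast_card_exists_le
    (q := fun v F => ∃ w, 3 * lam < binLoad scatterLoc (copiesFor H v) F w) ?_ ?_
  · intro F hF
    obtain ⟨v, hv⟩ := exists_lt_card_remainingFor hF
    obtain ⟨m, hm⟩ := Finset.card_pos.1 hv
    obtain ⟨hm, ht⟩ := mem_remainingFor.1 hm
    obtain ⟨u, hu⟩ := Option.ne_none_iff_exists'.1 (finishPhase_holding_ne_none.1 hm).2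
    let γ : ScatterCopy H := ⟨u, ⟨m, hu⟩, ⟨0, numCopies_pos H⟩⟩
    have := capacity_lt_binLoad_of_finishPhase (γ := γ) hm
    exact ⟨v, scatterLoc F γ, by rw [← ht]; exact this⟩
  · intro v
    refine le_trans (le_of_eq (by congr)) (((negCorrelated_scatterLoc H).card_exists_overfull_le
      (card_copiesFor_le H v)).trans ?_)
    have hx := pow_le_pow_left₀ (by positivity) exp_two_le lam
    gcongr

open Classical in
-- Union bound over the destination and the set `B` of `b` surviving messages: all copies of
-- messages in `B` must sit in overfull relays. Only `κ` copies of each are considered, to keep `4 *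
-- (κ * b) ≤ n`.
theorem card_le_remaining_le (h0 : 0 < remaining H) (hM : remaining H ≤ n) {κ b : ℕ}
    (hκ : κ ≤ numCopies H) (hκ0 : 0 < κ) (hb : 0 < b) (hn : 4 * (κ * b) ≤ n) :
    ((Finset.univ.filter fun F : Scatter H =>
        b ≤ remaining (finishPhase rule s H F).holding).card : ℝ)
      ≤ Fintype.card (Scatter H) *
        (n * ((remaining H).choose b * ((κ * b : ℕ) * (3 / 4) ^ (κ * b)))) := by
  have hlam : remaining H ⌈/⌉ n = 1 :=
    le_antisymm (ceilDiv_le_one hM) (ceilDiv_pos h0)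
  have hcap : capacity H = 3 := by unfold capacity; rw [hlam]
  refine natCast_card_exists_le
    (q := fun v F => ∃ B ∈ (remainingFor H v).powersetCard b, ∀ γ ∈ copiesOfSet H B κ,
      3 < binLoad scatterLoc (copiesFor H v) F (scatterLoc F γ)) ?_ ?_
  · intro F hF
    obtain ⟨v, hv⟩ := exists_lt_card_remainingFor
      (show b - 1 < remaining (finishPhase rule s H F).holding by omega)
    obtain ⟨B, hB, hBc⟩ := Finset.exists_subset_card_eq
      (show b ≤ (remainingFor (finishPhase rule s H F).holding v).card by omega)
    refine ⟨v, B, Finset.mem_powersetCard.2 ⟨fun m hm => ?_, hBc⟩, fun γ hγ => ?_⟩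
    · obtain ⟨hm, ht⟩ := mem_remainingFor.1 (hB hm)
      exact mem_remainingFor.2 ⟨(finishPhase_holding_ne_none.1 hm).2, ht⟩
    · obtain ⟨hm, ht⟩ := mem_remainingFor.1 (hB (Finset.mem_filter.1 hγ).2.1)
      have := capacity_lt_binLoad_of_finishPhase hm
      rwa [hcap, ht] at this
  · intro v
    have hsub : (Finset.univ.filter fun F : Scatter H =>
        ∃ B ∈ (remainingFor H v).powersetCard b, ∀ γ ∈ copiesOfSet H B κ,
          3 < binLoad scatterLoc (copiesFor H v) F (scatterLoc F γ)) ⊆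
        ((remainingFor H v).powersetCard b).biUnion fun B =>
          Finset.univ.filter fun F : Scatter H => ∀ γ ∈ copiesOfSet H B κ,
            3 < binLoad scatterLoc (copiesFor H v) F (scatterLoc F γ) := by
      intro F hF
      obtain ⟨-, B, hB, h⟩ := Finset.mem_filter.1 hF
      exact Finset.mem_biUnion.2 ⟨B, hB, Finset.mem_filter.2 ⟨Finset.mem_univ _, h⟩⟩
    calc _ ≤ ∑ B ∈ (remainingFor H v).powersetCard b,
          ((Finset.univ.filter fun F : Scatter H => ∀ γ ∈ copiesOfSet H B κ,
            3 < binLoad scatterLoc (copiesFor H v) F (scatterLoc F γ)).card : ℝ) := by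
          exact_mod_cast (Finset.card_le_card hsub).trans Finset.card_biUnion_le
      _ ≤ ∑ _B ∈ (remainingFor H v).powersetCard b,
          (Fintype.card (Scatter H) : ℝ) * ((κ * b : ℕ) * (3 / 4) ^ (κ * b)) := by
          refine Finset.sum_le_sum fun B hB => ?_
          obtain ⟨hB, hBc⟩ := Finset.mem_powersetCard.1 hB
          have hc : (copiesOfSet H B κ).card = κ * b := by
            rw [card_copiesOfSet (fun m hm => (mem_remainingFor.1 (hB hm)).1) hκ, hBc]
          have hD : (copiesFor H v).card ≤ n := by
            simpa [hlam] using card_copiesFor_le H v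
          have hT : copiesOfSet H B κ ⊆ copiesFor H v := fun γ hγ =>
            mem_copiesFor.2 (mem_remainingFor.1 (hB (Finset.mem_filter.1 hγ).2.1)).2
          have := (negCorrelated_scatterLoc H).card_forall_overfull_le hD hT (by rwa [hc])
            (Finset.card_pos.1 (by rw [hc]; positivity))
          rw [hc] at this
          refine le_trans (le_of_eq (by congr)) this
      _ ≤ _ := by
          rw [Finset.sum_const, Finset.card_powersetCard, nsmul_eq_mul]
          have : ((remainingFor H v).card.choose b : ℝ) ≤ ((remaining H).choose b : ℝ) := by
            exact_mod_cast Nat.choose_le_choose b (card_remainingFor_le H v)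
          calc _ ≤ ((remaining H).choose b : ℝ) *
              (Fintype.card (Scatter H) * ((κ * b : ℕ) * (3 / 4) ^ (κ * b))) := by gcongr
            _ = _ := by ring

open Classical in
-- With `b` just above `n / κ'` and `M ≤ n / κ`, there are at most `(exp 1 * κ' / κ) ^ b` choices of
-- `b` survivors. Each has probability about `(3/4) ^ (κ * b)`, and `κ' ≤ 2 ^ (κ/4)` is small
-- against `(4/3) ^ κ`.
theorem card_lt_remaining_mul_le (h0 : 0 < remaining H) {κ κ' : ℕ} (hM : remaining H * κ ≤ n)
    (hκ : 6 ≤ κ) (hκ' : κ' ^ 4 ≤ 2 ^ κ) (h8 : 8 * κ ≤ κ') (hn : 8 * κ ≤ n) :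
    ((Finset.univ.filter fun F : Scatter H =>
        n < remaining (finishPhase rule s H F).holding * κ').card : ℝ)
      ≤ Fintype.card (Scatter H) * (n * (n * (1 / 2) ^ (n / κ' + 1))) := by
  set b := n / κ' + 1 with hb
  have hκ'0 : 0 < κ' := by omega
  have hb0 : 0 < b := Nat.succ_pos _
  have hb4 : 4 * (κ * b) ≤ n := by
    have h1 : 8 * κ * (n / κ') ≤ n := (Nat.mul_le_mul_right _ h8).trans (Nat.mul_div_le n κ')
    have h2 : 8 * (κ * b) = 8 * κ * (n / κ') + 8 * κ := by rw [hb]; ring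
    omega
  have hMn : remaining H ≤ n := le_trans (Nat.le_mul_of_pos_right _ (by omega)) hM
  have key := card_le_remaining_le (rule := rule) (s := s) h0 hMn (le_numCopies h0 hM) (by omega)
    hb0 hb4
  have hsub : (Finset.univ.filter fun F : Scatter H =>
      n < remaining (finishPhase rule s H F).holding * κ') ⊆ (Finset.univ.filter fun F : Scatter H =>
        b ≤ remaining (finishPhase rule s H F).holding) := by
    intro F hF
    rw [Finset.mem_filter] at hF ⊢
    exact ⟨hF.1, Nat.succ_le_of_lt ((Nat.div_lt_iff_lt_mul hκ'0).2 hF.2)⟩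
  refine (Nat.cast_le.2 (Finset.card_le_card hsub)).trans (key.trans ?_)
  refine mul_le_mul_of_nonneg_left (mul_le_mul_of_nonneg_left ?_ (Nat.cast_nonneg _))
    (Nat.cast_nonneg _)
  have hκr : (0 : ℝ) < κ := by exact_mod_cast (show 0 < κ by omega)
  have hbr : (0 : ℝ) < b := by exact_mod_cast hb0
  -- `6/5` exceeds the fourth root of `2`, and `(6/5) * (3/4) = 9/10` is still below `1`.
  have h1 : (κ' : ℝ) ≤ (6 / 5) ^ κ := by
    refine le_of_pow_le_pow_left₀ (n := 4) (by norm_num) (by positivity) ?_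
    calc (κ' : ℝ) ^ 4 ≤ 2 ^ κ := by exact_mod_cast hκ'
      _ ≤ ((6 / 5 : ℝ) ^ 4) ^ κ := pow_le_pow_left₀ (by norm_num) (by norm_num) κ
      _ = _ := by rw [← pow_mul, ← pow_mul, mul_comm]
  have h2 : (κ' : ℝ) * (3 / 4) ^ κ ≤ 1 := by
    calc (κ' : ℝ) * (3 / 4) ^ κ ≤ (6 / 5) ^ κ * (3 / 4) ^ κ := by gcongr
      _ = (9 / 10) ^ κ := by rw [← mul_pow]; norm_num
      _ ≤ 1 := pow_le_one₀ (by norm_num) (by norm_num)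
  have h3 : (remaining H : ℝ) / b ≤ κ' / κ := by
    rw [div_le_div_iff₀ hbr hκr]
    have : remaining H * κ ≤ κ' * b := by
      have := Nat.lt_mul_div_succ n hκ'0
      rw [hb]
      omega
    exact_mod_cast this
  have h4 : exp 1 * remaining H / b * (3 / 4) ^ κ ≤ 1 / 2 := by
    have he : exp 1 ≤ 3 := exp_one_lt_three.le
    have hκ6 : (6 : ℝ) ≤ κ := by exact_mod_cast hκ
    calc exp 1 * remaining H / b * (3 / 4) ^ κ
        = exp 1 * (remaining H / b) * (3 / 4) ^ κ := by ring
      _ ≤ exp 1 * (κ' / κ) * (3 / 4) ^ κ := by gcongr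
      _ = exp 1 / κ * (κ' * (3 / 4) ^ κ) := by ring
      _ ≤ 3 / 6 * 1 := by gcongr
      _ = 1 / 2 := by norm_num
  have h5 : ((κ * b : ℕ) : ℝ) ≤ n := by exact_mod_cast (show κ * b ≤ n by omega)
  calc ((remaining H).choose b : ℝ) * ((κ * b : ℕ) * (3 / 4) ^ (κ * b))
      ≤ (exp 1 * remaining H / b) ^ b * (n * (3 / 4) ^ (κ * b)) := by
        gcongr
        exact choose_le_exp_mul_div_pow _ _
    _ = n * (exp 1 * remaining H / b * (3 / 4) ^ κ) ^ b := by rw [mul_pow, pow_mul]; ring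
    _ ≤ _ := mul_le_mul_of_nonneg_left
        (pow_le_pow_left₀ (by positivity) h4 b) (Nat.cast_nonneg _)

open Classical in
-- The case `b = 1`: a single message survives. Only `κ / 4` of its copies are used, since at most
-- `n / 4` copies may be tracked.
theorem card_remaining_pos_le_of_mul_le (h0 : 0 < remaining H) {κ : ℕ}
    (hM : remaining H * κ ≤ n) (hκ : 4 ≤ κ) :
    ((Finset.univ.filter fun F : Scatter H =>
        0 < remaining (finishPhase rule s H F).holding).card : ℝ)
      ≤ Fintype.card (Scatter H) * (n * (n * (n * (3 / 4) ^ (κ / 4)))) := by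
  have hMn : remaining H ≤ n := le_trans (Nat.le_mul_of_pos_right _ (by omega)) hM
  have hκn : κ ≤ n := le_trans (Nat.le_mul_of_pos_left _ h0) hM
  have key := card_le_remaining_le (rule := rule) (s := s) (κ := κ / 4) h0 hMn
    ((Nat.div_le_self _ _).trans (le_numCopies h0 hM)) (by omega)
    (show 0 < 1 by omega) (by omega)
  refine key.trans ?_
  rw [Nat.choose_one_right, mul_one]
  have h1 : (remaining H : ℝ) ≤ n := by exact_mod_cast hMn
  have h2 : ((κ / 4 : ℕ) : ℝ) ≤ n := by exact_mod_cast (Nat.div_le_self _ _).trans hκn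
  gcongr

end Ag

/-! ### Sequences of phases -/

namespace Ag

variable {n : ℕ} {I : IDT n}

/-- The invariant of the algorithm: exactly the deleted messages have been received, the algorithm
has not terminated early, `K` holds for the number `M_r'` of remaining messages, and `ρ` bounds the
number of rounds so far plus the cost of the next redistribution. -/
structure Invariant (K : ℕ → Prop) (ρ : ℝ) (s : State I) : Prop where
  received : ∀ v m, m ∈ s.received v ↔ I.target m = v ∧ s.holding m = none
  halted : s.halted = true → remaining s.holding = 0
  remaining : K (remaining s.holding)
  rounds : ∀ u, (s.rounds : ℝ) + (heldCount s.holding u : ℝ) / n ≤ ρ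

theorem remaining_initial (I : IDT n) : remaining (initial I).holding = I.maxReceive := by
  classical
  rw [remaining_eq]
  unfold IDT.maxReceive
  congr 1
  ext v
  congr 1
  ext m
  simp [mem_remainingFor, initial, IDT.toReceive]

theorem heldCount_initial_le (I : IDT n) (u : Fin n) :
    heldCount (initial I).holding u ≤ I.maxSend := by
  classical
  refine le_trans (le_of_eq ?_)
    (Finset.le_sup (f := fun v => (I.toSend v).card) (Finset.mem_univ u))
  unfold heldCount IDT.toSend initial
  congr 1
  ext m
  simp

variable [NeZero n]

open Classical in
/-- A phase that starts with `K M_r'` ends with `K' M_r'`, up to probability `ε`. -/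
def Step (rule : ForwardRule I) (ε : ℝ) (K K' : ℕ → Prop) : Prop :=
  K' 0 ∧ ∀ (s : State I) (H : Holding I), 0 < remaining H → K (remaining H) →
    ((Finset.univ.filter fun F : Scatter H =>
      ¬ K' (remaining (finishPhase rule s H F).holding)).card : ℝ) ≤ Fintype.card (Scatter H) * ε

/-- After `t` phases the invariant holds, up to probability `ε`. -/
def HoldsAfter (rule : ForwardRule I) (t : ℕ) (ε : ℝ) (K : ℕ → Prop) (ρ : ℝ) : Prop :=
  (run rule t).toOuterMeasure {s | Invariant K ρ s}ᶜ ≤ ENNReal.ofReal ε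

variable {rule : ForwardRule I} {K K' L : ℕ → Prop} {ε δ ρ : ℝ}

/-- The number of remaining messages never grows, so a downward closed property can be carried along
at no cost in probability. -/
theorem Step.and (h : Step rule ε K K') (hL : ∀ a b, a ≤ b → L b → L a) (hL0 : L 0) :
    Step rule ε (fun M => K M ∧ L M) (fun M => K' M ∧ L M) := by
  classical
  refine ⟨⟨h.1, hL0⟩, fun s H h0 hK => le_trans ?_ (h.2 s H h0 hK.1)⟩
  refine Nat.cast_le.2 (Finset.card_le_card fun F hF => ?_)
  have hF' := ((@Finset.mem_filter _ _ (_) _ _).1 hF).2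
  exact (@Finset.mem_filter _ _ (_) _ _).2
    ⟨Finset.mem_univ _, fun h' => hF' ⟨h', hL _ _ remaining_finishPhase_le hK.2⟩⟩

theorem HoldsAfter.mono {t : ℕ} (h : HoldsAfter rule t ε K ρ) (hK : ∀ M, K M → K' M) :
    HoldsAfter rule t ε K' ρ := by
  refine le_trans (MeasureTheory.measure_mono (Set.compl_subset_compl.2 fun s hs => ?_)) h
  exact ⟨hs.received, hs.halted, hK _ hs.remaining, hs.rounds⟩

/-- The union bound along a Markov chain: failure comes from a bad state before the step, or from a
bad step out of a good state. -/
theorem toOuterMeasure_bind_le {α β : Type} (p : PMF α) (f : α → PMF β) {S : Set α} {S' : Set β}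
    {x : ENNReal} (h : ∀ a ∈ S, (f a).toOuterMeasure S'ᶜ ≤ x) :
    (p.bind f).toOuterMeasure S'ᶜ ≤ p.toOuterMeasure Sᶜ + x := by
  rw [PMF.toOuterMeasure_bind_apply, PMF.toOuterMeasure_apply]
  have hle : ∀ a, p a * (f a).toOuterMeasure S'ᶜ ≤ Sᶜ.indicator p a + p a * x := by
    intro a
    by_cases ha : a ∈ S
    · exact (mul_le_mul_right (h a ha) _).trans le_add_self
    · rw [Set.indicator_of_mem (Set.mem_compl ha)]
      have h1 : (f a).toOuterMeasure S'ᶜ ≤ 1 := by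
        calc (f a).toOuterMeasure S'ᶜ ≤ (f a).toOuterMeasure Set.univ :=
              MeasureTheory.measure_mono (Set.subset_univ _)
          _ = 1 := (PMF.toOuterMeasure_apply_eq_one_iff _ _).2 (Set.subset_univ _)
      calc p a * (f a).toOuterMeasure S'ᶜ ≤ p a * 1 := mul_le_mul_right h1 _
        _ ≤ _ := by rw [mul_one]; exact le_self_add
  calc _ ≤ ∑' a, (Sᶜ.indicator p a + p a * x) := ENNReal.tsum_le_tsum hle
    _ = _ := by rw [ENNReal.tsum_add, ENNReal.tsum_mul_right, p.tsum_coe, one_mul]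

theorem phase_of_halted {s : State I} (h : s.halted = true) : phase rule s = PMF.pure s := by
  unfold phase
  rw [if_pos h]

theorem phase_of_remaining_eq_zero {s : State I} (h : ¬ s.halted = true)
    (h0 : remaining s.holding = 0) :
    phase rule s = PMF.pure { s with rounds := s.rounds + 1, halted := true } := by
  unfold phase
  rw [if_neg h, if_pos (remaining_eq_zero_iff.1 h0)]

theorem phase_of_remaining_pos {s : State I} (h : ¬ s.halted = true)
    (h0 : 0 < remaining s.holding) :
    phase rule s = (PMF.uniformOfFintype (Scatter (redistribute s.holding))).map
        (finishPhase rule s (redistribute s.holding)) := by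
  unfold phase
  rw [if_neg h, if_neg (fun h' => h0.ne' (remaining_eq_zero_iff.2 h'))]

theorem toOuterMeasure_phase_le {x : ℝ} (hx0 : 0 ≤ x) (hx : ∀ M, K M → (M : ℝ) / n ≤ x)
    (hstep : Step rule δ K K') {s : State I} (hs : Invariant K ρ s) :
    (phase rule s).toOuterMeasure {s | Invariant K' (ρ + 9 + 6 * x) s}ᶜ ≤ ENNReal.ofReal δ := by
  classical
  have hn := Nat.pos_of_ne_zero (NeZero.ne n)
  by_cases hh : s.halted = true
  · rw [phase_of_halted hh, PMF.toOuterMeasure_pure_apply, if_neg]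
    · exact zero_le
    · rw [Set.notMem_compl_iff]
      exact ⟨hs.received, hs.halted, by rw [hs.halted hh]; exact hstep.1, fun u => by
        have := hs.rounds u
        linarith⟩
  rcases Nat.eq_zero_or_pos (remaining s.holding) with h0 | h0
  · rw [phase_of_remaining_eq_zero hh h0, PMF.toOuterMeasure_pure_apply, if_neg]
    · exact zero_le
    · rw [Set.notMem_compl_iff]
      refine ⟨hs.received, fun _ => h0, by rw [h0]; exact hstep.1, fun u => ?_⟩
      have := hs.rounds u
      push_cast
      linarith
  · rw [phase_of_remaining_pos hh h0, PMF.toOuterMeasure_map_apply]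
    have hsub : (finishPhase rule s (redistribute s.holding) ⁻¹'
        {s | Invariant K' (ρ + 9 + 6 * x) s}ᶜ) ⊆
        {F : Scatter (redistribute s.holding) |
          ¬ K' (remaining (finishPhase rule s (redistribute s.holding) F).holding)} := by
      intro F hF hK'
      refine hF ⟨fun v m => received_finishPhase (fun v m => ?_) v m, fun h => ?_, hK', fun u => ?_⟩
      · rw [redistribute_eq_none]; exact hs.received v m
      · unfold finishPhase at h
        simp at h
      · refine (rounds_finishPhase_le F hs.rounds u).trans ?_
        have := hx _ hs.remaining
        linarith
    refine (MeasureTheory.measure_mono hsub).trans ?_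
    rw [PMF.toOuterMeasure_uniformOfFintype_apply]
    have hstep' := hstep.2 s (redistribute s.holding) (by rwa [remaining_redistribute])
      (by rw [remaining_redistribute]; exact hs.remaining)
    have hcard : Fintype.card {F : Scatter (redistribute s.holding) |
          ¬ K' (remaining (finishPhase rule s (redistribute s.holding) F).holding)}
        = (Finset.univ.filter fun F : Scatter (redistribute s.holding) =>
          ¬ K' (remaining (finishPhase rule s (redistribute s.holding) F).holding)).card :=
      Fintype.card_subtype _
    have hpos : (0 : ℝ) < Fintype.card (Scatter (redistribute s.holding)) := by
      exact_mod_cast Fintype.card_pos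
    rw [hcard]
    refine ENNReal.div_le_of_le_mul ?_
    have hδ : 0 ≤ δ := by
      by_contra hneg
      have h1 := mul_neg_of_pos_of_neg hpos (not_le.1 hneg)
      have h2 := hstep'.trans_lt h1
      exact absurd h2 (not_lt.2 (Nat.cast_nonneg _))
    rw [← ENNReal.ofReal_natCast, ← ENNReal.ofReal_natCast, ← ENNReal.ofReal_mul hδ]
    refine ENNReal.ofReal_le_ofReal ?_
    rw [mul_comm]
    exact hstep'

theorem HoldsAfter.step {t : ℕ} (h : HoldsAfter rule t ε K ρ) (hε : 0 ≤ ε) (hδ : 0 ≤ δ) {x : ℝ}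
    (hx0 : 0 ≤ x) (hx : ∀ M, K M → (M : ℝ) / n ≤ x) (hstep : Step rule δ K K') :
    HoldsAfter rule (t + 1) (ε + δ) K' (ρ + 9 + 6 * x) := by
  unfold HoldsAfter
  rw [ENNReal.ofReal_add hε hδ]
  exact (toOuterMeasure_bind_le _ _ fun s hs => toOuterMeasure_phase_le hx0 hx hstep hs).trans
    (add_le_add_left h _)

theorem holdsAfter_zero (rule : ForwardRule I) :
    HoldsAfter rule 0 0 (fun M => M = I.maxReceive) ((I.maxSend : ℝ) / n) := by
  unfold HoldsAfter run
  rw [PMF.toOuterMeasure_pure_apply, if_neg]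
  · exact zero_le
  · rw [Set.notMem_compl_iff]
    refine ⟨fun v m => by simp [initial], fun h => by simp [initial] at h, remaining_initial I,
      fun u => ?_⟩
    have : (heldCount (initial I).holding u : ℝ) ≤ I.maxSend := by
      exact_mod_cast heldCount_initial_le I u
    have h2 : ((initial I).rounds : ℝ) = 0 := by simp [initial]
    rw [h2, zero_add]
    gcongr

theorem toOuterMeasure_phase_solvedWithin_of_solvedWithin {B : ℝ} {s : State I}
    (hs : SolvedWithin B s) : (phase rule s).toOuterMeasure {s | SolvedWithin B s}ᶜ ≤ 0 := by
  rw [phase_of_halted hs.1, PMF.toOuterMeasure_pure_apply,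
    if_neg (show s ∉ {s | SolvedWithin B s}ᶜ from fun h => h hs)]

theorem toOuterMeasure_phase_solvedWithin {B : ℝ} {s : State I}
    (hs : Invariant (fun M => M = 0) ρ s) (hB : ρ + 1 ≤ B) :
    (phase rule s).toOuterMeasure {s | SolvedWithin B s}ᶜ ≤ 0 := by
  have hrec : ∀ v, s.received v = I.toReceive v := by
    intro v
    ext m
    rw [hs.received]
    simp only [IDT.toReceive, Finset.mem_filter, Finset.mem_univ, true_and]
    exact ⟨fun h => h.1, fun h => ⟨h, remaining_eq_zero_iff.1 hs.remaining m⟩⟩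
  have hr : (s.rounds : ℝ) ≤ ρ := by
    have h1 := hs.rounds 0
    have : (0 : ℝ) ≤ (heldCount s.holding 0 : ℝ) / n := by positivity
    linarith
  by_cases hh : s.halted = true
  · exact toOuterMeasure_phase_solvedWithin_of_solvedWithin ⟨hh, by linarith, hrec⟩
  · rw [phase_of_remaining_eq_zero hh hs.remaining, PMF.toOuterMeasure_pure_apply, if_neg]
    rw [Set.notMem_compl_iff]
    refine ⟨rfl, ?_, hrec⟩
    push_cast
    linarith

/-- Once no messages remain, one more phase of one round detects this; that is the `+ 1` in both
hypotheses. Solved states are absorbing, so looking later, after `⌊B⌋₊` phases, does no harm. -/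
theorem HoldsAfter.le_probSolvedWithin {t : ℕ} (h : HoldsAfter rule t ε (fun M => M = 0) ρ)
    (hε : 0 ≤ ε) {B : ℝ} (hB : ρ + 1 ≤ B) (ht : (t : ℝ) + 1 ≤ B) :
    ENNReal.ofReal (1 - ε) ≤ probSolvedWithin rule B := by
  have hall : ∀ t', t + 1 ≤ t' →
      (run rule t').toOuterMeasure {s | SolvedWithin B s}ᶜ ≤ ENNReal.ofReal ε := by
    intro t' ht'
    induction t', ht' using Nat.le_induction with
    | base =>
      refine (toOuterMeasure_bind_le _ _ fun s hs =>
        toOuterMeasure_phase_solvedWithin hs hB).trans ?_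
      rw [add_zero]
      exact h
    | succ t' _ ih =>
      refine (toOuterMeasure_bind_le _ _ fun s hs =>
        toOuterMeasure_phase_solvedWithin_of_solvedWithin hs).trans ?_
      rw [add_zero]
      exact ih
  have h1 := hall ⌊B⌋₊ (Nat.le_floor (by push_cast; exact ht))
  have huniv : (run rule ⌊B⌋₊).toOuterMeasure Set.univ = 1 :=
    (PMF.toOuterMeasure_apply_eq_one_iff _ _).2 (Set.subset_univ _)
  have hle : (1 : ENNReal) ≤ probSolvedWithin rule B + ENNReal.ofReal ε := by
    rw [← huniv, ← Set.union_compl_self {s | SolvedWithin B s}]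
    exact (MeasureTheory.measure_union_le _ _).trans (add_le_add_right h1 _)
  rw [ENNReal.ofReal_sub _ hε, ENNReal.ofReal_one]
  exact tsub_le_iff_right.2 hle

end Ag

/-! ### The iterated logarithm and the schedule of the phases -/

theorem lt_tower (k : ℕ) : k < tower k := by
  induction k with
  | zero => simp [tower]
  | succ k ih => exact lt_of_le_of_lt ih Nat.lt_two_pow_self

theorem tower_mono : Monotone tower :=
  monotone_nat_of_le_succ fun k => (Nat.lt_two_pow_self (n := tower k)).le

theorem le_tower_logStar (x : ℝ) : x ≤ tower (logStar x) := by
  obtain ⟨k, hk⟩ := exists_nat_ge x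
  exact Nat.sInf_mem (s := {k : ℕ | x ≤ (tower k : ℝ)})
    ⟨k, hk.trans (by exact_mod_cast (lt_tower k).le)⟩

theorem tower_lt_of_lt_logStar {x : ℝ} {k : ℕ} (h : k < logStar x) : (tower k : ℝ) < x := by
  have : k ∉ {k : ℕ | x ≤ (tower k : ℝ)} := Nat.notMem_of_lt_sInf h
  exact not_le.1 this

theorem logStar_le {x : ℝ} {k : ℕ} (h : x ≤ tower k) : logStar x ≤ k := Nat.sInf_le h

theorem logStar_mono {x y : ℝ} (h : x ≤ y) : logStar x ≤ logStar y :=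
  logStar_le (h.trans (le_tower_logStar y))

theorem logStar_natCast_le (n : ℕ) : logStar n ≤ n :=
  logStar_le (by exact_mod_cast (lt_tower n).le)

/-- From `36` on, `2 ^ (κ / 4)` outgrows `κ` by the factor required in `card_lt_remaining_mul_le`.
-/
theorem eight_mul_le_two_pow {κ : ℕ} (h : 36 ≤ κ) : 8 * κ ≤ 2 ^ (κ / 4) := by
  have key : ∀ j, 9 ≤ j → 32 * (j + 1) ≤ 2 ^ j := by
    intro j hj
    induction j, hj using Nat.le_induction with
    | base => norm_num
    | succ j hj ih => rw [pow_succ]; omega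
  have := key (κ / 4) (by omega)
  omega

theorem le_two_pow_div_four {κ : ℕ} (h : 36 ≤ κ) : κ ≤ 2 ^ (κ / 4) / 4 := by
  have := eight_mul_le_two_pow h
  omega

/-- Iterating `κ ↦ min (2 ^ (κ / 4)) s` twice is faster than climbing a step of the tower. -/
theorem min_tower_succ_le {κ s i : ℕ} (hκ : 36 ≤ κ) (hκs : κ ≤ s) (h : min (tower i) s ≤ κ) :
    min (tower (i + 1)) s ≤ min (2 ^ (min (2 ^ (κ / 4)) s / 4)) s := by
  refine le_min ?_ (min_le_right _ _)
  rcases le_total (2 ^ (κ / 4)) s with h1 | h1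
  · rw [min_eq_left h1]
    rcases le_total (tower i) s with h2 | h2
    · rw [min_eq_left h2] at h
      refine (min_le_left _ _).trans ?_
      exact Nat.pow_le_pow_right (by norm_num) (h.trans (le_two_pow_div_four hκ))
    · rw [min_eq_right h2] at h
      refine (min_le_right _ _).trans (h.trans ?_)
      exact (le_two_pow_div_four hκ).trans Nat.lt_two_pow_self.le
  · rw [min_eq_right h1]
    refine (min_le_right _ _).trans ?_
    have := eight_mul_le_two_pow (hκ.trans hκs)
    omega

/-! ### Progress of single phases and the schedules built from them. -/

namespace Ag

variable {n : ℕ} {I : IDT n}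

theorem Invariant.mono_rounds {K : ℕ → Prop} {ρ ρ' : ℝ} {s : State I} (h : Invariant K ρ s)
    (hρ : ρ ≤ ρ') : Invariant K ρ' s :=
  ⟨h.received, h.halted, h.remaining, fun u => (h.rounds u).trans hρ⟩

/-- A bound on the probability that a phase makes less progress than it should. -/
noncomputable def failure (n : ℕ) : ℝ := (n : ℝ) ^ 3 * (9 / 10) ^ (n.sqrt / 32)

theorem failure_nonneg (n : ℕ) : 0 ≤ failure n := by unfold failure; positivity

theorem mul_pow_le_failure {a b : ℝ} {e : ℕ} (ha : a ≤ (n : ℝ) ^ 3) (hb0 : 0 ≤ b)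
    (hb : b ≤ 9 / 10) (he : n.sqrt / 32 ≤ e) : a * b ^ e ≤ failure n := by
  unfold failure
  refine mul_le_mul ha ?_ (by positivity) (by positivity)
  calc b ^ e ≤ (9 / 10) ^ e := pow_le_pow_left₀ hb0 hb e
    _ ≤ _ := pow_le_pow_of_le_one (by norm_num) (by norm_num) he

variable [NeZero n] {rule : ForwardRule I} {K K' : ℕ → Prop}

theorem HoldsAfter.mono_rounds {t : ℕ} {ε ρ ρ' : ℝ} (h : HoldsAfter rule t ε K ρ) (hρ : ρ ≤ ρ') :
    HoldsAfter rule t ε K ρ' :=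
  le_trans (MeasureTheory.measure_mono (Set.compl_subset_compl.2 fun _ hs => hs.mono_rounds hρ)) h

/-- Once `M ≤ n`, the cost `9 + 6 * M / n` of a phase is at most `15`. -/
theorem HoldsAfter.step_of_le {t : ℕ} {ε ρ : ℝ} (h : HoldsAfter rule t (t * ε) K (ρ + 15 * t))
    (hε : 0 ≤ ε) (hK : ∀ M, K M → M ≤ n) (hstep : Step rule ε K K') :
    HoldsAfter rule (t + 1) ((t + 1 : ℕ) * ε) K' (ρ + 15 * (t + 1 : ℕ)) := by
  have hn : (0 : ℝ) < n := by exact_mod_cast Nat.pos_of_ne_zero (NeZero.ne n)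
  have h1 := h.step (mul_nonneg (Nat.cast_nonneg t) hε) hε zero_le_one
    (fun M hM => by rw [div_le_one hn]; exact_mod_cast hK M hM) hstep
  have e1 : ((t + 1 : ℕ) : ℝ) * ε = t * ε + ε := by push_cast; ring
  have e2 : ρ + 15 * ((t + 1 : ℕ) : ℝ) = ρ + 15 * t + 9 + 6 * 1 := by push_cast; ring
  rw [e1, e2]
  exact h1

theorem Step.of_card {ε : ℝ} (h0 : K' 0) (p : ℕ → Prop) [DecidablePred p]
    (hp : ∀ M, ¬ K' M → p M)
    (h : ∀ (s : State I) (H : Holding I), 0 < remaining H → K (remaining H) →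
      ((Finset.univ.filter fun F : Scatter H =>
        p (remaining (finishPhase rule s H F).holding)).card : ℝ)
          ≤ Fintype.card (Scatter H) * ε) : Step rule ε K K' := by
  refine ⟨h0, fun s H hH hK => le_trans ?_ (h s H hH hK)⟩
  refine Nat.cast_le.2 (Finset.card_le_card fun F hF => ?_)
  have hF' := ((@Finset.mem_filter _ _ (_) _ _).1 hF).2
  exact (@Finset.mem_filter _ _ (_) _ _).2 ⟨Finset.mem_univ _, hp _ hF'⟩

theorem one_le_cast : (1 : ℝ) ≤ n := by exact_mod_cast Nat.pos_of_ne_zero (NeZero.ne n)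

theorem step_three_mul {κ : ℕ} (hK : ∀ H : Holding I, 0 < remaining H → K (remaining H) →
    κ ≤ numCopies H) : Step rule (failure n) K (fun M => M * (3 * κ) ≤ n) := by
  refine Step.of_card (by simp) (fun M => n < 3 * κ * M) (fun M hM => ?_) fun s H h0 h => ?_
  · rw [mul_comm]; omega
  · refine le_trans (card_lt_three_mul_remaining_le h0 (hK H h0 h)) ?_
    gcongr
    refine mul_pow_le_failure ?_ (by norm_num) le_rfl
      ((Nat.div_le_self _ _).trans (Nat.sqrt_le_self n))
    exact le_self_pow₀ one_le_cast (by norm_num)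

theorem step_min_two_pow {κ : ℕ} (hκ : 36 ≤ κ) (hκs : κ ≤ n.sqrt / 8) :
    Step rule (failure n) (fun M => M * κ ≤ n)
      (fun M => M * min (2 ^ (κ / 4)) (n.sqrt / 8) ≤ n) := by
  -- The cap here is `√n`, not `√n / 8`, so that `8 * κ ≤ κ'` still holds when `κ` has reached `√n /
  -- 8`. It also keeps `n / κ'` at least `√n`, which makes the failure probability small.
  set κ' := min (2 ^ (κ / 4)) n.sqrt with hκ'
  have hr : n.sqrt ≤ n := Nat.sqrt_le_self n
  have h8 : 8 * κ ≤ κ' := le_min (eight_mul_le_two_pow hκ) (by omega)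
  refine Step.of_card (by simp) (fun M => n < M * κ') (fun M hM => ?_) fun s H h0 h => ?_
  · refine lt_of_lt_of_le (not_le.1 hM) (Nat.mul_le_mul_left M ?_)
    exact min_le_min_left _ (Nat.div_le_self _ _)
  · refine le_trans (card_lt_remaining_mul_le h0 h (by omega) ?_ h8 (by omega)) ?_
    · calc κ' ^ 4 ≤ (2 ^ (κ / 4)) ^ 4 := Nat.pow_le_pow_left (min_le_left _ _) 4
        _ = 2 ^ (κ / 4 * 4) := (pow_mul _ _ _).symm
        _ ≤ 2 ^ κ := Nat.pow_le_pow_right (by norm_num) (Nat.div_mul_le_self κ 4)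
    · gcongr
      rw [← mul_assoc]
      refine mul_pow_le_failure ?_ (by norm_num) (by norm_num) ?_
      · rw [← sq]
        exact pow_le_pow_right₀ one_le_cast (by norm_num)
      · have h1 : n.sqrt ≤ n / κ' := by
          rw [Nat.le_div_iff_mul_le (by omega)]
          exact (Nat.mul_le_mul_left _ (min_le_right _ _)).trans (Nat.sqrt_le n)
        have := Nat.div_le_self n.sqrt 32
        omega

theorem step_zero (hs : 4 ≤ n.sqrt / 8) :
    Step rule (failure n) (fun M => M * (n.sqrt / 8) ≤ n) (fun M => M = 0) := by
  refine Step.of_card rfl (fun M => 0 < M) (fun M hM => Nat.pos_of_ne_zero hM) fun s H h0 h => ?_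
  refine le_trans (card_remaining_pos_le_of_mul_le h0 h hs) ?_
  gcongr
  rw [← mul_assoc, ← mul_assoc]
  refine mul_pow_le_failure (le_of_eq (by ring)) (by norm_num) (by norm_num) ?_
  omega

theorem step_pred (k : ℕ) : Step rule 0 (fun M => M ≤ k + 1) (fun M => M ≤ k) := by
  refine Step.of_card (Nat.zero_le _) (fun M => k < M) (fun M hM => not_le.1 hM)
    fun s H h0 h => ?_
  rw [mul_zero]
  refine le_of_eq (Nat.cast_eq_zero.2 (Finset.card_eq_zero.2 (Finset.filter_eq_empty_iff.2 ?_)))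
  intro F _
  have := remaining_finishPhase_lt (rule := rule) (s := s) (F := F) h0
  omega

/-- Only the first phase may have `M > n`; it is charged `6 * M_r / n`. The `2 * d + 7` phases are
one to get `3 * M ≤ n`, three triplings up to `81`, two for each of `d + 1` levels of the tower, and
a last one that clears everything. -/
theorem holdsAfter_of_large (rule : ForwardRule I) (hs : 81 ≤ n.sqrt / 8) {d : ℕ}
    (hd : logStar (n : ℝ) ≤ logStar ((n : ℝ) / I.maxReceive) + d) :
    HoldsAfter rule (2 * d + 7) ((2 * d + 7 : ℕ) * failure n) (fun M => M = 0)
      (((I.maxSend : ℝ) / n + 6 * ((I.maxReceive : ℝ) / n)) + 15 * (2 * d + 7 : ℕ)) := by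
  have hn := Nat.pos_of_ne_zero (NeZero.ne n)
  have hε := failure_nonneg n
  set ρ := (I.maxSend : ℝ) / n + 6 * ((I.maxReceive : ℝ) / n) with hρ
  set L : ℕ → Prop := fun M => M ≤ I.maxReceive with hL
  have hLm : ∀ a b, a ≤ b → L b → L a := fun a b h h' => h.trans h'
  have hL0 : L 0 := Nat.zero_le _
  have triple : ∀ κ, 0 < κ →
      Step rule (failure n) (fun M => M * κ ≤ n ∧ L M) (fun M => M * (3 * κ) ≤ n ∧ L M) :=
    fun κ _ => (step_three_mul fun H h0 h => le_numCopies h0 h).and hLm hL0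
  have hle : ∀ {κ : ℕ}, 0 < κ → ∀ M, M * κ ≤ n ∧ L M → M ≤ n := fun hκ M h =>
    (Nat.le_mul_of_pos_right M hκ).trans h.1
  have h1 : HoldsAfter rule 1 ((1 : ℕ) * failure n) (fun M => M * 3 ≤ n ∧ L M)
      (ρ + 15 * (1 : ℕ)) := by
    have h0 := (holdsAfter_zero rule).mono (K' := fun M => True ∧ L M) (fun M h => ⟨trivial, h.le⟩)
    have hst : Step rule (failure n) (fun M => True ∧ L M) (fun M => M * 3 ≤ n ∧ L M) :=
      (step_three_mul (κ := 1) fun H _ _ => numCopies_pos H).and hLm hL0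
    have := h0.step le_rfl hε (x := (I.maxReceive : ℝ) / n) (by positivity) (fun M hM => by
      gcongr
      exact_mod_cast hM.2) hst
    rw [Nat.cast_one, one_mul, ← zero_add (failure n)]
    refine this.mono_rounds ?_
    rw [hρ]
    linarith
  have h4 := ((h1.step_of_le hε (hle (by norm_num)) (triple 3 (by norm_num))).step_of_le hε
    (hle (by norm_num)) (triple 9 (by norm_num))).step_of_le hε
    (hle (by norm_num)) (triple 27 (by norm_num))
  set s := n.sqrt / 8 with hsdef
  set a := logStar ((n : ℝ) / I.maxReceive) with ha
  have climb : ∀ j, ∃ κ, 81 ≤ κ ∧ κ ≤ s ∧ min (tower (a - 1 + j)) s ≤ κ ∧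
      HoldsAfter rule (4 + 2 * j) ((4 + 2 * j : ℕ) * failure n) (fun M => M * κ ≤ n)
        (ρ + 15 * (4 + 2 * j : ℕ)) := by
    intro j
    induction j with
    | zero =>
      -- `tower (a - 1) < n / M_r` by minimality of `a`, so the instance itself provides this start.
      -- If `a = 0`, truncation gives `tower 0 = 1`, and `81` takes over.
      refine ⟨min (max 81 (tower (a - 1))) s, le_min (le_max_left _ _) hs, min_le_right _ _,
        min_le_min_right _ (le_max_right _ _), ?_⟩
      refine h4.mono fun M hM => ?_
      refine (Nat.mul_le_mul_left M (min_le_left _ _)).trans ?_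
      rcases le_total (tower (a - 1)) 81 with h81 | h81
      · rw [max_eq_left h81]
        exact hM.1
      · rw [max_eq_right h81]
        have hapos : a - 1 < a := by
          by_contra hc
          have : a - 1 = 0 := by omega
          rw [this] at h81
          simp [tower] at h81
        have hlt := tower_lt_of_lt_logStar hapos
        rcases Nat.eq_zero_or_pos I.maxReceive with h0 | h0
        · have : M = 0 := Nat.le_zero.1 (h0 ▸ hM.2)
          simp [this]
        · rw [lt_div_iff₀ (by exact_mod_cast h0)] at hlt
          have hlt' : tower (a - 1) * I.maxReceive < n := by exact_mod_cast hlt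
          refine le_trans ?_ hlt'.le
          rw [mul_comm]
          exact Nat.mul_le_mul_left _ hM.2
    | succ j ih =>
      obtain ⟨κ, hκ, hκs, htow, hκh⟩ := ih
      have hge : ∀ κ, 81 ≤ κ → κ ≤ s → 81 ≤ min (2 ^ (κ / 4)) s := by
        intro κ hκ hκs
        have := eight_mul_le_two_pow (show 36 ≤ κ by omega)
        exact le_min (by omega) hs
      have hle' : ∀ {κ : ℕ}, 81 ≤ κ → ∀ M, M * κ ≤ n → M ≤ n := fun hκ M h =>
        (Nat.le_mul_of_pos_right M (by omega)).trans h
      have hκ1 := hge κ hκ hκs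
      refine ⟨min (2 ^ (min (2 ^ (κ / 4)) s / 4)) s, hge _ hκ1 (min_le_right _ _),
        min_le_right _ _, min_tower_succ_le (by omega) hκs htow, ?_⟩
      exact (hκh.step_of_le hε (hle' hκ) (step_min_two_pow (by omega) hκs)).step_of_le hε
        (hle' hκ1) (step_min_two_pow (by omega) (min_le_right _ _))
  -- The climb starts at level `a - 1`, so `d + 1` levels reach at least `a + d ≥ log* n`, where the
  -- tower is at least `n` and hence exceeds the cap `s`.
  obtain ⟨κ, hκ, hκs, htow, hκh⟩ := climb (d + 1)
  have hκeq : κ = s := by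
    refine le_antisymm hκs ((le_min ?_ le_rfl).trans htow)
    have h2 : (n : ℝ) ≤ tower (logStar (n : ℝ)) := le_tower_logStar _
    have h3 : n ≤ tower (logStar (n : ℝ)) := by exact_mod_cast h2
    have h4 : s ≤ n := (Nat.div_le_self _ _).trans (Nat.sqrt_le_self n)
    exact h4.trans (h3.trans (tower_mono (by omega)))
  subst hκeq
  have := hκh.step_of_le hε (fun M h => (Nat.le_mul_of_pos_right M (by omega)).trans h)
    (step_zero (by omega))
  have e : 4 + 2 * (d + 1) + 1 = 2 * d + 7 := by ring
  rw [e] at this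
  exact this

/-- For instances with `M_r` large compared to `n`: the single-relay tail bound is exponentially
small in `⌈M_r/n⌉`, so that probably no relay is overfull in the first phase. -/
theorem holdsAfter_one (rule : ForwardRule I) :
    HoldsAfter rule 1 (n * (n * (28 / 100) ^ (I.maxReceive ⌈/⌉ n))) (fun M => M = 0)
      ((I.maxSend : ℝ) / n + 9 + 6 * ((I.maxReceive : ℝ) / n)) := by
  have hst : Step rule (n * (n * (28 / 100) ^ (I.maxReceive ⌈/⌉ n)))
      (fun M => M = I.maxReceive) (fun M => M = 0) := by
    refine Step.of_card rfl (fun M => 0 < M) (fun M hM => Nat.pos_of_ne_zero hM) fun s H _ h => ?_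
    rw [← h]
    exact card_remaining_pos_le
  have := (holdsAfter_zero rule).step le_rfl (by positivity)
    (x := (I.maxReceive : ℝ) / n) (by positivity) (fun M hM => by rw [hM]) hst
  rwa [zero_add ((n : ℝ) * _)] at this

/-- Only the deterministic decrease by one per phase is used, hence the error probability `0`. -/
theorem holdsAfter_of_maxReceive_le (rule : ForwardRule I) {N : ℕ} (hN : I.maxReceive ≤ N) :
    HoldsAfter rule N 0 (fun M => M = 0)
      ((I.maxSend : ℝ) / n + N * (9 + 6 * ((N : ℝ) / n))) := by
  have h : ∀ t ≤ N, HoldsAfter rule t 0 (fun M => M ≤ N - t)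
      ((I.maxSend : ℝ) / n + t * (9 + 6 * ((N : ℝ) / n))) := by
    intro t
    induction t with
    | zero =>
      intro _
      rw [Nat.cast_zero, zero_mul, add_zero]
      exact (holdsAfter_zero rule).mono fun M hM => by omega
    | succ t ih =>
      intro ht
      have h1 := (ih (by omega)).mono (K' := fun M => M ≤ N - (t + 1) + 1) fun M hM => by omega
      have := h1.step le_rfl le_rfl (x := (N : ℝ) / n) (by positivity) (fun M hM => by
        gcongr
        omega) (step_pred (N - (t + 1)))
      rw [zero_add] at this
      refine this.mono_rounds (le_of_eq ?_)
      push_cast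
      ring
  exact (h N le_rfl).mono fun M hM => by omega

/-- The decay of `(9/10) ^ (√n / 32)` beats every power of `n`. The factor `9 * n` will bound the
number `2 * d + 7` of phases. -/
theorem exists_nat_failure_le (c : ℝ) :
    ∃ n₀ : ℕ, ∀ n : ℕ, n₀ ≤ n → 81 ≤ n.sqrt / 8 ∧ 9 * n * failure n ≤ (n : ℝ) ^ (-c) := by
  obtain ⟨p, hp⟩ := exists_nat_ge (c + 4)
  have h1 : Filter.Tendsto (fun j : ℕ => (j : ℝ) ^ (2 * p) * (9 / 10 : ℝ) ^ j) Filter.atTop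
      (nhds 0) :=
    tendsto_pow_const_mul_const_pow_of_abs_lt_one (2 * p) (by rw [abs_of_pos] <;> norm_num)
  have h2 : ∀ᶠ j : ℕ in Filter.atTop, (j : ℝ) ^ (2 * p) * (9 / 10 : ℝ) ^ j
      < 1 / (9 * 64 ^ (2 * p)) := h1.eventually_lt_const (by positivity)
  obtain ⟨j₀, hj₀⟩ := Filter.eventually_atTop.1 h2
  -- The `21` ensures `√n ≥ 32 * 21 ≥ 8 * 81`.
  refine ⟨(32 * (j₀ + 21)) * (32 * (j₀ + 21)), fun n hn => ?_⟩
  have hr : 32 * (j₀ + 21) ≤ n.sqrt := Nat.le_sqrt.2 hn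
  refine ⟨by omega, ?_⟩
  set j := n.sqrt / 32 with hj
  have hjn : n ≤ (64 * j) ^ 2 := by
    have h3 := Nat.lt_succ_sqrt n
    have h4 : n.sqrt + 1 ≤ 64 * j := by omega
    calc n ≤ (n.sqrt + 1) * (n.sqrt + 1) := h3.le
      _ ≤ (64 * j) * (64 * j) := Nat.mul_le_mul h4 h4
      _ = _ := (sq _).symm
  have hn1 : (1 : ℝ) ≤ n := by
    have : 1 ≤ n := le_trans (Nat.mul_pos (by omega) (by omega)) hn
    exact_mod_cast this
  have h5 := hj₀ j (by omega)
  have h6 : (n : ℝ) ^ p ≤ 64 ^ (2 * p) * (j : ℝ) ^ (2 * p) := by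
    calc (n : ℝ) ^ p ≤ (((64 * j : ℕ) : ℝ) ^ 2) ^ p := by
          gcongr
          exact_mod_cast hjn
      _ = _ := by rw [← pow_mul]; push_cast; rw [mul_pow]
  have h7 : 9 * ((n : ℝ) ^ p * (9 / 10) ^ j) ≤ 1 := by
    rw [lt_div_iff₀ (by positivity)] at h5
    calc 9 * ((n : ℝ) ^ p * (9 / 10) ^ j)
        ≤ 9 * (64 ^ (2 * p) * (j : ℝ) ^ (2 * p) * (9 / 10) ^ j) := by gcongr
      _ = (j : ℝ) ^ (2 * p) * (9 / 10) ^ j * (9 * 64 ^ (2 * p)) := by ring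
      _ ≤ 1 := h5.le
  have h8 : (n : ℝ) ^ (4 : ℕ) = (n : ℝ) ^ (4 : ℝ) := by
    rw [← Real.rpow_natCast]; norm_num
  have hn0 : (0 : ℝ) < n := by linarith
  have h9 : (n : ℝ) ^ (4 : ℕ) ≤ (n : ℝ) ^ p * (n : ℝ) ^ (-c) := by
    rw [h8, ← Real.rpow_natCast (n : ℝ) p, ← Real.rpow_add hn0]
    exact Real.rpow_le_rpow_of_exponent_le hn1 (by linarith)
  unfold failure
  calc 9 * (n : ℝ) * ((n : ℝ) ^ 3 * (9 / 10) ^ j) = 9 * ((n : ℝ) ^ 4 * (9 / 10) ^ j) := by ring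
    _ ≤ 9 * (((n : ℝ) ^ p * (n : ℝ) ^ (-c)) * (9 / 10) ^ j) := by gcongr
    _ = 9 * ((n : ℝ) ^ p * (9 / 10) ^ j) * (n : ℝ) ^ (-c) := by ring
    _ ≤ 1 * (n : ℝ) ^ (-c) := by gcongr
    _ = _ := one_mul _

end Ag

theorem mainTheorem6 (c : ℝ) (hc : 0 < c) :
    ∃ C : ℝ, 0 < C ∧ ∀ (n : ℕ) [NeZero n] (I : IDT n) (rule : Ag.ForwardRule I),
      ENNReal.ofReal (1 - (n : ℝ) ^ (-c)) ≤
        Ag.probSolvedWithin rule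
          (C * (((I.maxSend : ℝ) + (I.maxReceive : ℝ)) / (n : ℝ)
            + ((logStar (n : ℝ) : ℝ) - (logStar ((n : ℝ) / (I.maxReceive : ℝ)) : ℝ))
            + 1)) := by
  obtain ⟨n₀, hn₀⟩ := Ag.exists_nat_failure_le c
  -- Chosen so that for every `n ≤ n₀`, `⌈M_r/n⌉ ≥ lam₀` makes the failure probability of a single
  -- phase at most `n ^ (-c)`. If instead `⌈M_r/n⌉ < lam₀`, then `M_r ≤ N`.
  obtain ⟨lam₀, hlam₀⟩ : ∃ lam₀ : ℕ,
      (28 / 100 : ℝ) ^ lam₀ < ((n₀ : ℝ) + 1) ^ (-c) / ((n₀ : ℝ) + 1) ^ 2 :=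
    exists_pow_lt_of_lt_one (by positivity) (by norm_num)
  set N := lam₀ * n₀ with hN
  -- `200` covers `15 * (2 * d + 7) + 1` and the multiples of `M_s / n` and `M_r / n`; the other
  -- summand pays for the at most `N` deterministic phases when `n` and `M_r` are both bounded.
  refine ⟨200 + N * (9 + 6 * (N : ℝ)), by positivity, fun n hne I rule => ?_⟩
  have hn : (0 : ℝ) < n := by exact_mod_cast Nat.pos_of_ne_zero (NeZero.ne n)
  have hn1 : (1 : ℝ) ≤ n := Ag.one_le_cast
  have hmono : logStar ((n : ℝ) / (I.maxReceive : ℝ)) ≤ logStar (n : ℝ) := by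
    refine logStar_mono ?_
    rcases Nat.eq_zero_or_pos I.maxReceive with h0 | h0
    · rw [h0, Nat.cast_zero, div_zero]; exact hn.le
    · exact div_le_self hn.le (by exact_mod_cast h0)
  obtain ⟨d, hd⟩ := Nat.exists_eq_add_of_le hmono
  have hdr : (logStar (n : ℝ) : ℝ) - (logStar ((n : ℝ) / (I.maxReceive : ℝ)) : ℝ) = d := by
    rw [hd]; push_cast; ring
  rw [hdr, add_div]
  set x := (I.maxSend : ℝ) / n with hx
  set y := (I.maxReceive : ℝ) / n with hy
  have hx0 : 0 ≤ x := by positivity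
  have hy0 : 0 ≤ y := by positivity
  have hd0 : (0 : ℝ) ≤ d := Nat.cast_nonneg d
  have hA0 : (0 : ℝ) ≤ N * (9 + 6 * (N : ℝ)) := by positivity
  have hNN : (N : ℝ) ≤ N * (9 + 6 * (N : ℝ)) := by
    have : (0 : ℝ) ≤ N := Nat.cast_nonneg N
    nlinarith
  set A := (N : ℝ) * (9 + 6 * (N : ℝ)) with hA
  have hprod : A ≤ A * (x + y + d + 1) := le_mul_of_one_le_right hA0 (by linarith)
  have hB : 200 * (x + y + d + 1) + A ≤ (200 + A) * (x + y + d + 1) := by linarith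
  have of_holds : ∀ {t : ℕ} {ε ρ : ℝ}, Ag.HoldsAfter rule t ε (fun M => M = 0) ρ → 0 ≤ ε →
      ε ≤ (n : ℝ) ^ (-c) → ρ + 1 ≤ (200 + A) * (x + y + d + 1) →
      (t : ℝ) + 1 ≤ (200 + A) * (x + y + d + 1) →
      ENNReal.ofReal (1 - (n : ℝ) ^ (-c)) ≤
        Ag.probSolvedWithin rule ((200 + A) * (x + y + d + 1)) := by
    intro t ε ρ h hε hεc hρ ht
    exact (ENNReal.ofReal_le_ofReal (by linarith)).trans (h.le_probSolvedWithin hε hρ ht)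
  by_cases hlarge : n₀ ≤ n
  · obtain ⟨hs, hf⟩ := hn₀ n hlarge
    have hε := Ag.failure_nonneg n
    refine of_holds (Ag.holdsAfter_of_large rule hs hd.le) (by positivity) ?_ ?_ ?_
    · refine le_trans ?_ hf
      gcongr
      have h1 : logStar (n : ℝ) ≤ n := logStar_natCast_le n
      have h2 : 1 ≤ n := Nat.pos_of_ne_zero (NeZero.ne n)
      have h3 : 2 * d + 7 ≤ 9 * n := by omega
      exact_mod_cast h3
    · push_cast
      linarith
    · push_cast
      linarith
  · have hnn₀ : n ≤ n₀ := (not_le.1 hlarge).le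
    by_cases hlam : lam₀ ≤ I.maxReceive ⌈/⌉ n
    · refine of_holds (Ag.holdsAfter_one rule) (by positivity) ?_ (by linarith)
        (by push_cast; linarith)
      have hnn : (n : ℝ) ≤ (n₀ : ℝ) + 1 := by
        have : (n : ℝ) ≤ n₀ := by exact_mod_cast hnn₀
        linarith
      rw [lt_div_iff₀ (by positivity)] at hlam₀
      calc (n : ℝ) * (n * (28 / 100) ^ (I.maxReceive ⌈/⌉ n))
          ≤ ((n₀ : ℝ) + 1) * (((n₀ : ℝ) + 1) * (28 / 100) ^ lam₀) := by
            have : (28 / 100 : ℝ) ^ (I.maxReceive ⌈/⌉ n) ≤ (28 / 100) ^ lam₀ :=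
              pow_le_pow_of_le_one (by norm_num) (by norm_num) hlam
            gcongr
        _ = (28 / 100) ^ lam₀ * ((n₀ : ℝ) + 1) ^ 2 := by ring
        _ ≤ ((n₀ : ℝ) + 1) ^ (-c) := hlam₀.le
        _ ≤ (n : ℝ) ^ (-c) :=
            Real.rpow_le_rpow_of_nonpos hn hnn (by linarith)
    · have hMN : I.maxReceive ≤ N :=
        (Ag.le_ceilDiv_mul I.maxReceive).trans (Nat.mul_le_mul (not_le.1 hlam).le hnn₀)
      refine of_holds (Ag.holdsAfter_of_maxReceive_le rule hMN) le_rfl (by positivity) ?_ ?_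
      · have h1 : (N : ℝ) / n ≤ N := div_le_self (Nat.cast_nonneg N) hn1
        have h2 : (N : ℝ) * (9 + 6 * ((N : ℝ) / n)) ≤ A := by
          rw [hA]
          gcongr
        linarith
      · linarith
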